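/- Let $r\ge 3$ be an integer with $r\neq 4$, put $q=e^{2\pi\sqrt{-1}/r}$ and $q^z=e^{2\pi\sqrt{-1}z/r}$ for $z\in\mathbb C$. For $n\ge 0$ let $[n]=\frac{q^{-n}-(-q)^n}{q+q^{-1}}$ and $[n]!=[1][2]\cdots[n]$ (with $[0]!=1$), and let $\bar r$ be the least positive integer with $[\bar r]=0$. Let $\overline U$ be the restricted unrolled quantum group of $\mathfrak{osp}(1|2)$: the unital $\mathbb C$-superalgebra with even generators $H,K,K^{-1}$, odd generators $E,F$ and relations $$HK=KH,\quad HK^{-1}=K^{-1}H,\quad HE-EH=2E,\quad HF-FH=-2F,\quad KK^{-1}=K^{-1}K=1,$$ $$KE=q^2EK,\quad KF=q^{-2}FK,\quad EF+FE=\frac{K-K^{-1}}{q-q^{-1}},\quad E^{\bar r}=F^{\bar r}=0,$$ with counit $\epsilon(H)=\epsilon(E)=\epsilon(F)=0$, $\epsilon(K)=1$ and coproduct $\Delta(H)=H\otimes1+1\otimes H$, $\Delta(K)=K\otimes K$, $\Delta(E)=1\otimes E+E\otimes K$, $\Delta(F)=K^{-1}\otimes F+F\otimes 1$. Let $\mathcal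 C$ be the category of finite dimensional weight modules: finite dimensional super vector spaces $V=V_{\bar0}\oplus V_{\bar1}$ with an action of the superalgebra $\overline U$ such that $H$ is diagonalizable and $Kv=q^{\lambda}v$ whenever $Hv=\lambda v$; the morphisms are the parity-preserving $\overline U$-linear maps. It is a monoidal category via $\Delta$ and $\epsilon$, where $\overline U\otimes\overline U$ acts on $V\otimes W$ by $(a\otimes b)(v\otimes w)=(-1)^{|b||v|}av\otimes bw$. For $V,W\in\mathcal C$ let $\tilde R_{V,W}$ be the action on $V\otimes W$ of $$\tilde R=\sum_{l=0}^{\bar r-1}(-1)^l\,\frac{q^{l(l-1)/2}(q-q^{-1})^l}{[l]!}\,E^l\otimes F^l\in\overline U\otimes\overline U,$$ let $\Upsilon_{V,W}(v\otimes w)=q^{\lambda_v\lambda_w/2}\,v\otimes w$ for $v,w$ of weights $\lambda_v,\lambda_w$, let $\tau_{V,W}(v\otimes w)=(-1)^{|v||w|}w\otimes v$, and put $c_{V,W}=\tau_{V,W}\circ\Upsilon_{V,W}\circ\tilde R_{V,W}$. Then the maps $c_{V,W}:V\otimes W\to W\otimes V$, $V,W\in\mathcal C$, define a braiding on $\mathcal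 C$: they are isomorphisms of $\overline U$-modules, natural in $V$ and $W$, and satisfy both hexagon axioms. -/

import Mathlib

open CategoryTheory TensorProduct

namespace OspUnrolled

/-! ### Scalars -/

/-- `q ^ z = exp (2 π i z / r)`. -/
noncomputable def qpow (r : ℕ) (z : ℂ) : ℂ :=
  Complex.exp (2 * Real.pi * Complex.I * z / r)

/-- `q = exp (2 π i / r)`. -/
noncomputable def q (r : ℕ) : ℂ := qpow r 1

/-- The super quantum integer `[n] = (q⁻ⁿ - (-q)ⁿ) / (q + q⁻¹)`. -/
noncomputable def sqInt (r n : ℕ) : ℂ :=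
  ((q r)⁻¹ ^ n - (-q r) ^ n) / (q r + (q r)⁻¹)

/-- The super quantum factorial `[n]! = [1] [2] ⋯ [n]`. -/
noncomputable def sqFact (r n : ℕ) : ℂ := ∏ i ∈ Finset.range n, sqInt r (i + 1)

/-- The least positive integer `n` with `[n] = 0`. -/
noncomputable def rbar (r : ℕ) : ℕ := sInf {n | 0 < n ∧ sqInt r n = 0}

lemma qpow_add (r : ℕ) (a b : ℂ) : qpow r (a + b) = qpow r a * qpow r b := by
  unfold qpow
  rw [← Complex.exp_add]
  ring_nf

lemma qpow_zero (r : ℕ) : qpow r 0 = 1 := by simp [qpow]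

lemma q_ne_zero (r : ℕ) : q r ≠ 0 := Complex.exp_ne_zero _

lemma q_isPrimitiveRoot (r : ℕ) [h : Fact (3 ≤ r)] : IsPrimitiveRoot (q r) r := by
  have h3 := h.out
  have := Complex.isPrimitiveRoot_exp r (by omega)
  simpa [q, qpow] using this

lemma one_add_q_sq_ne_zero (r : ℕ) [h3 : Fact (3 ≤ r)] [h4 : Fact (r ≠ 4)] :
    1 + q r ^ 2 ≠ 0 := by
  intro h
  have h' : q r ^ 4 = 1 := by
    have : q r ^ 2 = -1 := by linear_combination h
    calc q r ^ 4 = (q r ^ 2) ^ 2 := by ring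
      _ = 1 := by rw [this]; norm_num
  have hd := (q_isPrimitiveRoot r).dvd_of_pow_eq_one _ h'
  have h3 := h3.out
  have h4 := h4.out
  have := Nat.le_of_dvd (by norm_num) hd
  interval_cases r
  · omega
  · omega

lemma q_add_inv_ne_zero (r : ℕ) [Fact (3 ≤ r)] [Fact (r ≠ 4)] : q r + (q r)⁻¹ ≠ 0 := by
  intro h
  apply one_add_q_sq_ne_zero r
  have := q_ne_zero r
  field_simp at h
  linear_combination h

lemma exists_sqInt_eq_zero (r : ℕ) [h3 : Fact (3 ≤ r)] :
    {n | 0 < n ∧ sqInt r n = 0}.Nonempty := by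
  have h3' := h3.out
  refine ⟨2 * r, by omega, ?_⟩
  have h := (q_isPrimitiveRoot r).pow_eq_one
  have h2 : q r ^ (2 * r) = 1 := by rw [mul_comm, pow_mul, h, one_pow]
  rw [sqInt, Even.neg_pow (even_two_mul r), inv_pow, h2, inv_one, sub_self, zero_div]

lemma rbar_pos (r : ℕ) [Fact (3 ≤ r)] : 0 < rbar r := (Nat.sInf_mem (exists_sqInt_eq_zero r)).1

lemma sqInt_rbar (r : ℕ) [Fact (3 ≤ r)] : sqInt r (rbar r) = 0 :=
  (Nat.sInf_mem (exists_sqInt_eq_zero r)).2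

lemma sqInt_ne_zero {r n : ℕ} (h0 : 0 < n) (hn : n < rbar r) : sqInt r n ≠ 0 := fun h =>
  Nat.notMem_of_lt_sInf hn ⟨h0, h⟩

lemma geom_sum_eq_zero_iff (r n : ℕ) [Fact (3 ≤ r)] [Fact (r ≠ 4)] :
    ∑ i ∈ Finset.range n, (-q r ^ 2) ^ i = 0 ↔ sqInt r n = 0 := by
  have hq := q_ne_zero r
  have h1 := q_add_inv_ne_zero r
  have h2 := one_add_q_sq_ne_zero r
  have hg := mul_neg_geom_sum (-q r ^ 2) n
  have hs : q r ^ n * ((q r)⁻¹ ^ n - (-q r) ^ n) = 1 - (-q r ^ 2) ^ n := by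
    rw [mul_sub, ← mul_pow, ← mul_pow, mul_inv_cancel₀ hq]
    ring
  rw [sqInt, div_eq_zero_iff, or_iff_left h1]
  constructor
  · intro h
    rw [h, mul_zero] at hg
    rw [← hg] at hs
    exact (mul_eq_zero.1 hs).resolve_left (pow_ne_zero _ hq)
  · intro h
    rw [h, mul_zero] at hs
    rw [← hs] at hg
    refine (mul_eq_zero.1 hg).resolve_left ?_
    rwa [sub_neg_eq_add]

section SkewBinomial

/-- Gaussian binomial coefficients `[i + j, i]` in the parameter `z`. -/
def gaussCoeff (z : ℂ) : ℕ → ℕ → ℂ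
  | 0, _ => 1
  | _ + 1, 0 => 1
  | i + 1, j + 1 => gaussCoeff z i (j + 1) + z ^ (i + 1) * gaussCoeff z (i + 1) j

lemma gaussCoeff_mul (z : ℂ) (i j : ℕ) :
    gaussCoeff z i j * (∏ k ∈ Finset.range i, ∑ l ∈ Finset.range (k + 1), z ^ l) *
      (∏ k ∈ Finset.range j, ∑ l ∈ Finset.range (k + 1), z ^ l) =
      ∏ k ∈ Finset.range (i + j), ∑ l ∈ Finset.range (k + 1), z ^ l := by
  fun_induction gaussCoeff z i j with
  | case1 j => simp
  | case2 i => simp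
  | case3 i j ih1 ih2 =>
    rw [show i + 1 + (j + 1) = (i + j + 1) + 1 by ring, Finset.prod_range_succ _ (i + j + 1)]
    rw [show i + (j + 1) = i + j + 1 by ring] at ih1
    rw [show i + 1 + j = i + j + 1 by ring] at ih2
    rw [show i + j + 1 + 1 = (i + 1) + (j + 1) by ring, Finset.sum_range_add _ (i + 1) (j + 1)]
    simp only [pow_add z (i + 1), ← Finset.mul_sum]
    rw [mul_add]
    nth_rewrite 1 [← ih1]
    rw [← ih2]
    rw [Finset.prod_range_succ _ i, Finset.prod_range_succ _ j]
    ring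

lemma add_pow_skew {A : Type*} [Ring A] [Algebra ℂ A] (z : ℂ) (x y : A)
    (h : y * x = z • (x * y)) (n : ℕ) :
    (x + y) ^ n = ∑ p ∈ Finset.HasAntidiagonal.antidiagonal n, gaussCoeff z p.1 p.2 • (x ^ p.1 * y ^ p.2) := by
  have hyx : ∀ k, y * x ^ k = z ^ k • (x ^ k * y) := by
    intro k
    induction k with
    | zero => simp
    | succ k ih =>
      rw [pow_succ, ← mul_assoc, ih, smul_mul_assoc, mul_assoc, h, mul_smul_comm, smul_smul,
        pow_succ, mul_assoc]
  induction n with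
  | zero => simp [gaussCoeff]
  | succ n ih =>
    have key : ∀ p ∈ Finset.HasAntidiagonal.antidiagonal (n + 1),
        gaussCoeff z p.1 p.2 • (x ^ p.1 * y ^ p.2) =
          (if p.1 = 0 then 0 else gaussCoeff z (p.1 - 1) p.2 • (x ^ p.1 * y ^ p.2)) +
          (if p.2 = 0 then 0 else
            (z ^ p.1 * gaussCoeff z p.1 (p.2 - 1)) • (x ^ p.1 * y ^ p.2)) := by
      rintro ⟨i, j⟩ hp
      rw [Finset.HasAntidiagonal.mem_antidiagonal] at hp
      rcases i with _ | i <;> rcases j with _ | j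
      · simp at hp
      · simp [gaussCoeff]
      · cases i <;> simp [gaussCoeff]
      · simp [gaussCoeff, add_smul]
    rw [Finset.sum_congr rfl key, Finset.sum_add_distrib, Finset.Nat.sum_antidiagonal_succ,
      Finset.Nat.sum_antidiagonal_succ', pow_succ', ih, add_mul, Finset.mul_sum, Finset.mul_sum]
    simp only [if_true, zero_add, Nat.add_one_sub_one, Nat.succ_ne_zero, if_false]
    congr 1
    · refine Finset.sum_congr rfl fun p _ => ?_
      rw [mul_smul_comm, ← mul_assoc, pow_succ']
    · refine Finset.sum_congr rfl fun p _ => ?_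
      rw [mul_smul_comm, ← mul_assoc, hyx, smul_mul_assoc, smul_smul, mul_comm (z ^ _), mul_assoc,
        ← pow_succ']

lemma add_pow_rbar_eq_zero {A : Type*} [Ring A] [Algebra ℂ A] (r : ℕ) [Fact (3 ≤ r)]
    [Fact (r ≠ 4)] (x y : A) (h : y * x = (-q r ^ 2) • (x * y)) (hx : x ^ rbar r = 0)
    (hy : y ^ rbar r = 0) : (x + y) ^ rbar r = 0 := by
  rw [add_pow_skew _ x y h]
  refine Finset.sum_eq_zero ?_
  rintro ⟨i, j⟩ hp
  rw [Finset.HasAntidiagonal.mem_antidiagonal] at hp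
  dsimp only at hp ⊢
  rcases Nat.eq_zero_or_pos i with rfl | hi
  · rw [zero_add] at hp
    simp [hp, hy]
  rcases Nat.eq_zero_or_pos j with rfl | hj
  · rw [add_zero] at hp
    simp [hp, hx]
  have hne : ∀ m < rbar r,
      ∏ k ∈ Finset.range m, ∑ l ∈ Finset.range (k + 1), (-q r ^ 2) ^ l ≠ 0 := by
    intro m hm
    refine Finset.prod_ne_zero_iff.2 fun k hk => ?_
    rw [Finset.mem_range] at hk
    rw [Ne, geom_sum_eq_zero_iff]
    exact sqInt_ne_zero (Nat.succ_pos k) (by omega)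
  have hz : ∏ k ∈ Finset.range (i + j), ∑ l ∈ Finset.range (k + 1), (-q r ^ 2) ^ l = 0 := by
    refine Finset.prod_eq_zero (i := i + j - 1) (Finset.mem_range.2 (by omega)) ?_
    rw [geom_sum_eq_zero_iff, show i + j - 1 + 1 = rbar r by omega, sqInt_rbar]
  have := gaussCoeff_mul (-q r ^ 2) i j
  rw [hz] at this
  have h0 : gaussCoeff (-q r ^ 2) i j = 0 :=
    (mul_eq_zero.1 ((mul_eq_zero.1 this).resolve_right (hne j (by omega)))).resolve_right
      (hne i (by omega))
  rw [h0, zero_smul]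

end SkewBinomial

/-! ### The restricted unrolled quantum group -/

/-- The generators `H, K, K⁻¹, E, F`. -/
inductive Gen
  | H | K | Kinv | E | F

open FreeAlgebra in
/-- The defining relations; `H, K, K⁻¹` are even and `E, F` are odd, so that the
supercommutator `[E, F]` is `E F + F E`. -/
inductive Rel (r : ℕ) : FreeAlgebra ℂ Gen → FreeAlgebra ℂ Gen → Prop
  | HK : Rel r (ι ℂ .H * ι ℂ .K) (ι ℂ .K * ι ℂ .H)
  | HKinv : Rel r (ι ℂ .H * ι ℂ .Kinv) (ι ℂ .Kinv * ι ℂ .H)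
  | HE : Rel r (ι ℂ .H * ι ℂ .E - ι ℂ .E * ι ℂ .H) ((2 : ℂ) • ι ℂ .E)
  | HF : Rel r (ι ℂ .H * ι ℂ .F - ι ℂ .F * ι ℂ .H) ((-2 : ℂ) • ι ℂ .F)
  | KKinv : Rel r (ι ℂ .K * ι ℂ .Kinv) 1
  | KinvK : Rel r (ι ℂ .Kinv * ι ℂ .K) 1
  | KE : Rel r (ι ℂ .K * ι ℂ .E) ((q r) ^ 2 • (ι ℂ .E * ι ℂ .K))
  | KF : Rel r (ι ℂ .K * ι ℂ .F) (((q r)⁻¹) ^ 2 • (ι ℂ .F * ι ℂ .K))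
  | EF : Rel r (ι ℂ .E * ι ℂ .F + ι ℂ .F * ι ℂ .E)
      ((q r - (q r)⁻¹)⁻¹ • (ι ℂ .K - ι ℂ .Kinv))
  | E_pow : Rel r (ι ℂ .E ^ rbar r) 0
  | F_pow : Rel r (ι ℂ .F ^ rbar r) 0

/-- The restricted unrolled quantum group of `osp(1|2)`, as a unital algebra: the quotient of the
unrolled quantum group by the two-sided ideal generated by `E ^ rbar` and `F ^ rbar`. -/
def Ubar (r : ℕ) : Type := RingQuot (Rel r)

noncomputable instance (r : ℕ) : Ring (Ubar r) := inferInstanceAs (Ring (RingQuot (Rel r)))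
noncomputable instance (r : ℕ) : Algebra ℂ (Ubar r) :=
  inferInstanceAs (Algebra ℂ (RingQuot (Rel r)))

namespace Ubar

variable {r : ℕ}

/-- The quotient map from the free algebra. -/
noncomputable def mk (r : ℕ) : FreeAlgebra ℂ Gen →ₐ[ℂ] Ubar r := RingQuot.mkAlgHom ℂ (Rel r)

/-- The class of a generator. -/
noncomputable def gen (r : ℕ) (g : Gen) : Ubar r := mk r (FreeAlgebra.ι ℂ g)

noncomputable def H : Ubar r := gen r .H
noncomputable def K : Ubar r := gen r .K
noncomputable def Kinv : Ubar r := gen r .Kinv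
noncomputable def E : Ubar r := gen r .E
noncomputable def F : Ubar r := gen r .F

lemma mk_rel {x y : FreeAlgebra ℂ Gen} (h : Rel r x y) : mk r x = mk r y :=
  RingQuot.mkAlgHom_rel ℂ h

lemma HK : (H * K : Ubar r) = K * H := by
  have := mk_rel (Rel.HK (r := r))
  rwa [map_mul, map_mul] at this
lemma HKinv : (H * Kinv : Ubar r) = Kinv * H := by
  have := mk_rel (Rel.HKinv (r := r))
  rwa [map_mul, map_mul] at this
lemma HE : (H * E - E * H : Ubar r) = (2 : ℂ) • E := by
  have := mk_rel (Rel.HE (r := r))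
  rwa [map_sub, map_mul, map_mul, map_smul] at this
lemma HF : (H * F - F * H : Ubar r) = (-2 : ℂ) • F := by
  have := mk_rel (Rel.HF (r := r))
  rwa [map_sub, map_mul, map_mul, map_smul] at this
lemma KKinv : (K * Kinv : Ubar r) = 1 := by
  have := mk_rel (Rel.KKinv (r := r))
  rwa [map_mul, map_one] at this
lemma KinvK : (Kinv * K : Ubar r) = 1 := by
  have := mk_rel (Rel.KinvK (r := r))
  rwa [map_mul, map_one] at this
lemma KE : (K * E : Ubar r) = (q r) ^ 2 • (E * K) := by
  have := mk_rel (Rel.KE (r := r))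
  rwa [map_mul, map_smul, map_mul] at this
lemma KF : (K * F : Ubar r) = ((q r)⁻¹) ^ 2 • (F * K) := by
  have := mk_rel (Rel.KF (r := r))
  rwa [map_mul, map_smul, map_mul] at this
lemma EF : (E * F + F * E : Ubar r) = (q r - (q r)⁻¹)⁻¹ • (K - Kinv) := by
  have := mk_rel (Rel.EF (r := r))
  rwa [map_add, map_mul, map_smul, map_mul, map_sub] at this
lemma E_pow : (E : Ubar r) ^ rbar r = 0 := by
  have := mk_rel (Rel.E_pow (r := r))
  rwa [map_pow, map_zero] at this
lemma F_pow : (F : Ubar r) ^ rbar r = 0 := by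
  have := mk_rel (Rel.F_pow (r := r))
  rwa [map_pow, map_zero] at this

lemma EKinv : (E * Kinv : Ubar r) = (q r) ^ 2 • (Kinv * E) := by
  calc (E * Kinv : Ubar r) = Kinv * (K * E) * Kinv := by
        rw [← mul_assoc, KinvK, one_mul]
    _ = _ := by rw [KE, mul_smul_comm, smul_mul_assoc, mul_assoc, mul_assoc, KKinv, mul_one]

lemma FKinv : (F * Kinv : Ubar r) = ((q r)⁻¹) ^ 2 • (Kinv * F) := by
  calc (F * Kinv : Ubar r) = Kinv * (K * F) * Kinv := by
        rw [← mul_assoc, KinvK, one_mul]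
    _ = _ := by rw [KF, mul_smul_comm, smul_mul_assoc, mul_assoc, mul_assoc, KKinv, mul_one]

/-- Operators satisfying the defining relations. -/
structure IsRep (r : ℕ) {A : Type*} [Ring A] [Algebra ℂ A] (h k k' e f : A) : Prop where
  HK : h * k = k * h
  HKinv : h * k' = k' * h
  HE : h * e - e * h = (2 : ℂ) • e
  HF : h * f - f * h = (-2 : ℂ) • f
  KKinv : k * k' = 1
  KinvK : k' * k = 1
  KE : k * e = (q r) ^ 2 • (e * k)
  KF : k * f = ((q r)⁻¹) ^ 2 • (f * k)
  EF : e * f + f * e = (q r - (q r)⁻¹)⁻¹ • (k - k')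
  E_pow : e ^ rbar r = 0
  F_pow : f ^ rbar r = 0

/-- The universal property of the presentation. -/
noncomputable def lift {A : Type*} [Ring A] [Algebra ℂ A] (h k k' e f : A)
    (hr : IsRep r h k k' e f) : Ubar r →ₐ[ℂ] A :=
  RingQuot.liftAlgHom ℂ ⟨FreeAlgebra.lift ℂ (fun g => match g with
    | .H => h | .K => k | .Kinv => k' | .E => e | .F => f), by
    intro x y hxy
    cases hxy <;> simp only [map_mul, map_sub, map_add, map_smul, map_one, map_zero, map_pow,
      FreeAlgebra.lift_ι_apply]
    exacts [hr.HK, hr.HKinv, hr.HE, hr.HF, hr.KKinv, hr.KinvK, hr.KE, hr.KF, hr.EF, hr.E_pow,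
      hr.F_pow]⟩

section lift

variable {A : Type*} [Ring A] [Algebra ℂ A] {h k k' e f : A} (hr : IsRep r h k k' e f)

lemma lift_gen (g : Gen) : lift h k k' e f hr (gen r g) = (match g with
    | .H => h | .K => k | .Kinv => k' | .E => e | .F => f) := by
  unfold lift gen mk
  erw [RingQuot.liftAlgHom_mkAlgHom_apply]
  rw [FreeAlgebra.lift_ι_apply]

@[simp] lemma lift_H : lift h k k' e f hr H = h := lift_gen hr .H
@[simp] lemma lift_K : lift h k k' e f hr K = k := lift_gen hr .K
@[simp] lemma lift_Kinv : lift h k k' e f hr Kinv = k' := lift_gen hr .Kinv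
@[simp] lemma lift_E : lift h k k' e f hr E = e := lift_gen hr .E
@[simp] lemma lift_F : lift h k k' e f hr F = f := lift_gen hr .F

end lift

lemma induction {p : Ubar r → Prop} (halg : ∀ c : ℂ, p (algebraMap ℂ _ c)) (hH : p H)
    (hK : p K) (hKinv : p Kinv) (hE : p E) (hF : p F) (hadd : ∀ a b, p a → p b → p (a + b))
    (hmul : ∀ a b, p a → p b → p (a * b)) (a : Ubar r) : p a := by
  obtain ⟨x, rfl⟩ : ∃ x, mk r x = a := RingQuot.mkAlgHom_surjective ℂ (Rel r) a
  induction x using FreeAlgebra.induction with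
  | grade0 c => simpa using halg c
  | grade1 g => cases g; exacts [hH, hK, hKinv, hE, hF]
  | mul a b ha hb => simpa using hmul _ _ ha hb
  | add a b ha hb => simpa using hadd _ _ ha hb

lemma algHom_ext {A : Type*} [Ring A] [Algebra ℂ A] {φ ψ : Ubar r →ₐ[ℂ] A}
    (hH : φ H = ψ H) (hK : φ K = ψ K) (hKinv : φ Kinv = ψ Kinv) (hE : φ E = ψ E)
    (hF : φ F = ψ F) : φ = ψ := by
  ext a
  induction a using Ubar.induction with
  | halg c => simp
  | hH => exact hH
  | hK => exact hK
  | hKinv => exact hKinv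
  | hE => exact hE
  | hF => exact hF
  | hadd a b ha hb => simp [ha, hb]
  | hmul a b ha hb => simp [ha, hb]

/-! ### The superalgebra structure -/

/-- The parity involution: the automorphism fixing `H, K, K⁻¹` and negating `E, F`. -/
noncomputable def parity (r : ℕ) : Ubar r →ₐ[ℂ] Ubar r :=
  lift H K Kinv (-E) (-F)
    { HK := HK
      HKinv := HKinv
      HE := by rw [mul_neg, neg_mul, smul_neg, ← HE]; abel
      HF := by rw [mul_neg, neg_mul, smul_neg, ← HF]; abel
      KKinv := KKinv
      KinvK := KinvK
      KE := by rw [mul_neg, neg_mul, smul_neg, KE]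
      KF := by rw [mul_neg, neg_mul, smul_neg, KF]
      EF := by rw [neg_mul_neg, neg_mul_neg, EF]
      E_pow := by rw [neg_pow, E_pow, mul_zero]
      F_pow := by rw [neg_pow, F_pow, mul_zero] }

@[simp] lemma parity_H : parity r H = H := lift_H _
@[simp] lemma parity_K : parity r K = K := lift_K _
@[simp] lemma parity_Kinv : parity r Kinv = Kinv := lift_Kinv _
@[simp] lemma parity_E : parity r E = -E := lift_E _
@[simp] lemma parity_F : parity r F = -F := lift_F _

@[simp] lemma parity_parity (a : Ubar r) : parity r (parity r a) = a := by
  have : (parity r).comp (parity r) = AlgHom.id ℂ _ := by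
    apply algHom_ext <;> simp
  exact DFunLike.congr_fun this a

/-- The `ℤ/2`-grading of the algebra: the eigenspaces of the parity involution. It is the unique
grading by algebra degrees for which `H, K, K⁻¹` are even and `E, F` are odd. -/
noncomputable def grading (r : ℕ) (i : ZMod 2) : Submodule ℂ (Ubar r) where
  carrier := {a | parity r a = ((-1 : ℤˣ) ^ i) • a}
  add_mem' := by intro a b ha hb; simp only [Set.mem_ofPred_eq] at *; rw [map_add, ha, hb, smul_add]
  zero_mem' := by simp
  smul_mem' := by
    intro c a ha; simp only [Set.mem_ofPred_eq] at *; rw [map_smul, ha, smul_comm]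

lemma mem_grading {i : ZMod 2} {a : Ubar r} :
    a ∈ grading r i ↔ parity r a = ((-1 : ℤˣ) ^ i) • a := Iff.rfl

lemma mem_grading_zero {a : Ubar r} : a ∈ grading r 0 ↔ parity r a = a := by
  rw [mem_grading, uzpow_zero, one_smul]

lemma mem_grading_one {a : Ubar r} : a ∈ grading r 1 ↔ parity r a = -a := by
  rw [mem_grading, uzpow_one]; simp [Units.smul_def]

/-- The component of degree `i` of an element of the algebra. -/
noncomputable def comp (i : ZMod 2) (a : Ubar r) : Ubar r :=
  (2 : ℂ)⁻¹ • (a + ((-1 : ℤˣ) ^ i) • parity r a)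

lemma comp_zero (a : Ubar r) : comp 0 a = (2 : ℂ)⁻¹ • (a + parity r a) := by
  rw [comp, uzpow_zero, one_smul]

lemma comp_one (a : Ubar r) : comp 1 a = (2 : ℂ)⁻¹ • (a - parity r a) := by
  rw [comp, uzpow_one]; simp [Units.smul_def, sub_eq_add_neg]

lemma comp_mem (i : ZMod 2) (a : Ubar r) : comp i a ∈ grading r i := by
  fin_cases i
  · change comp 0 a ∈ grading r 0
    rw [mem_grading_zero, comp_zero, map_smul, map_add, parity_parity, add_comm]
  · change comp 1 a ∈ grading r 1
    rw [mem_grading_one, comp_one, map_smul, map_sub, parity_parity, ← smul_neg, neg_sub]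

lemma comp_add_comp (a : Ubar r) : comp 0 a + comp 1 a = a := by
  rw [comp_zero, comp_one, ← smul_add, add_add_sub_cancel, ← two_smul ℂ a, smul_smul]
  norm_num

lemma comp_zero_of_mem_zero {a : Ubar r} (h : a ∈ grading r 0) : comp 0 a = a := by
  rw [comp_zero, mem_grading_zero.1 h, ← two_smul ℂ a, smul_smul]; norm_num

lemma comp_one_of_mem_zero {a : Ubar r} (h : a ∈ grading r 0) : comp 1 a = 0 := by
  rw [comp_one, mem_grading_zero.1 h, sub_self, smul_zero]

lemma comp_zero_of_mem_one {a : Ubar r} (h : a ∈ grading r 1) : comp 0 a = 0 := by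
  rw [comp_zero, mem_grading_one.1 h, add_neg_cancel, smul_zero]

lemma comp_one_of_mem_one {a : Ubar r} (h : a ∈ grading r 1) : comp 1 a = a := by
  rw [comp_one, mem_grading_one.1 h, sub_neg_eq_add, ← two_smul ℂ a, smul_smul]; norm_num

instance : SetLike.GradedMonoid (grading r) where
  one_mem := by rw [mem_grading_zero, map_one]
  mul_mem := by
    intro i j a b ha hb
    rw [mem_grading] at *
    rw [map_mul, ha, hb, uzpow_add, smul_mul_smul_comm]

noncomputable instance : DirectSum.Decomposition (grading r) where
  decompose' a := DirectSum.of (fun i => grading r i) 0 ⟨comp 0 a, comp_mem 0 a⟩ +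
    DirectSum.of (fun i => grading r i) 1 ⟨comp 1 a, comp_mem 1 a⟩
  left_inv a := by
    rw [map_add, DirectSum.coeAddMonoidHom_of, DirectSum.coeAddMonoidHom_of]
    exact comp_add_comp a
  right_inv x := by
    induction x using DirectSum.induction_on with
    | zero =>
      have h0 : ∀ i, comp i (0 : Ubar r) = 0 := by intro i; simp [comp]
      simp only [map_zero]
      have : ∀ i, (⟨comp i (0 : Ubar r), comp_mem i 0⟩ : grading r i) = 0 :=
        fun i => Subtype.ext (h0 i)
      rw [this, this, map_zero, map_zero, add_zero]
    | of i a =>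
      obtain ⟨a, ha⟩ := a
      rw [DirectSum.coeAddMonoidHom_of]
      fin_cases i
      · change a ∈ grading r 0 at ha
        have h1 : (⟨comp 0 a, comp_mem 0 a⟩ : grading r 0) = ⟨a, ha⟩ :=
          Subtype.ext (comp_zero_of_mem_zero ha)
        have h2 : (⟨comp 1 a, comp_mem 1 a⟩ : grading r 1) = 0 :=
          Subtype.ext (comp_one_of_mem_zero ha)
        change DirectSum.of (fun i => grading r i) 0 ⟨comp 0 a, comp_mem 0 a⟩ +
          DirectSum.of (fun i => grading r i) 1 ⟨comp 1 a, comp_mem 1 a⟩ = _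
        rw [h1, h2, map_zero, add_zero]
        rfl
      · change a ∈ grading r 1 at ha
        have h1 : (⟨comp 0 a, comp_mem 0 a⟩ : grading r 0) = 0 :=
          Subtype.ext (comp_zero_of_mem_one ha)
        have h2 : (⟨comp 1 a, comp_mem 1 a⟩ : grading r 1) = ⟨a, ha⟩ :=
          Subtype.ext (comp_one_of_mem_one ha)
        change DirectSum.of (fun i => grading r i) 0 ⟨comp 0 a, comp_mem 0 a⟩ +
          DirectSum.of (fun i => grading r i) 1 ⟨comp 1 a, comp_mem 1 a⟩ = _
        rw [h1, h2, map_zero, zero_add]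
        rfl
    | add x y hx hy =>
      rw [map_add]
      conv_rhs => rw [← hx, ← hy]
      have h : ∀ i (a b : Ubar r), (⟨comp i (a + b), comp_mem i (a + b)⟩ : grading r i) =
          ⟨comp i a, comp_mem i a⟩ + ⟨comp i b, comp_mem i b⟩ := by
        intro i a b
        apply Subtype.ext
        simp only [comp, map_add, Submodule.coe_add, smul_add]
        abel
      dsimp only
      rw [h, h, map_add, map_add]
      abel

noncomputable instance : GradedAlgebra (grading r) where

lemma H_mem : (H : Ubar r) ∈ grading r 0 := mem_grading_zero.2 parity_H
lemma K_mem : (K : Ubar r) ∈ grading r 0 := mem_grading_zero.2 parity_K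
lemma Kinv_mem : (Kinv : Ubar r) ∈ grading r 0 := mem_grading_zero.2 parity_Kinv
lemma E_mem : (E : Ubar r) ∈ grading r 1 := mem_grading_one.2 parity_E
lemma F_mem : (F : Ubar r) ∈ grading r 1 := mem_grading_one.2 parity_F
lemma one_mem : (1 : Ubar r) ∈ grading r 0 := mem_grading_zero.2 (map_one _)

/-! ### The coproduct and the counit -/

/-- The tensor square of the superalgebra: `(a ⊗ b) (c ⊗ d) = (-1)^(|b| |c|) a c ⊗ b d`. -/
abbrev Sq (r : ℕ) : Type := grading r ᵍ⊗[ℂ] grading r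

/-- The pure tensor `a ⊗ b` in the tensor square of the superalgebra. -/
noncomputable abbrev tm (a b : Ubar r) : Sq r := GradedTensorProduct.tmul ℂ a b

lemma tm_smul_left (c : ℂ) (a b : Ubar r) : tm (c • a) b = c • tm a b :=
  (TensorProduct.smul_tmul' c a b).symm

lemma tm_smul_right (c : ℂ) (a b : Ubar r) : tm a (c • b) = c • tm a b :=
  TensorProduct.tmul_smul c a b

lemma tm_sub_left (a b c : Ubar r) : tm (a - b) c = tm a c - tm b c :=
  TensorProduct.sub_tmul a b c

lemma tm_sub_right (a b c : Ubar r) : tm a (b - c) = tm a b - tm a c :=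
  TensorProduct.tmul_sub a b c

lemma tm_add_left (a b c : Ubar r) : tm (a + b) c = tm a c + tm b c :=
  TensorProduct.add_tmul a b c

lemma tm_add_right (a b c : Ubar r) : tm a (b + c) = tm a b + tm a c :=
  TensorProduct.tmul_add a b c

lemma tm_mul_of_even_left {b c : Ubar r} (a d : Ubar r) (hb : b ∈ grading r 0) :
    tm a b * tm c d = tm (a * c) (b * d) := by
  have h : ∀ i, ∀ c ∈ grading r i, tm a b * tm c d = tm (a * c) (b * d) := fun i c hc =>
    GradedTensorProduct.tmul_zero_coe_mul_coe_tmul (grading r) (grading r) a ⟨b, hb⟩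
      (⟨c, hc⟩ : grading r i) d
  rw [← comp_add_comp c]
  have hadd : ∀ x y z : Ubar r, tm (x + y) z = tm x z + tm y z := fun x y z =>
    tm_add_left x y z
  rw [hadd, mul_add, mul_add, hadd, h _ _ (comp_mem 0 c), h _ _ (comp_mem 1 c)]

lemma tm_mul_of_even_right {b c : Ubar r} (a d : Ubar r) (hc : c ∈ grading r 0) :
    tm a b * tm c d = tm (a * c) (b * d) := by
  have h : ∀ i, ∀ b ∈ grading r i, tm a b * tm c d = tm (a * c) (b * d) := fun i b hb =>
    GradedTensorProduct.tmul_coe_mul_zero_coe_tmul (grading r) (grading r) a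
      (⟨b, hb⟩ : grading r i) ⟨c, hc⟩ d
  rw [← comp_add_comp b]
  have hadd : ∀ x y z : Ubar r, tm z (x + y) = tm z x + tm z y := fun x y z =>
    tm_add_right z x y
  rw [hadd, add_mul, add_mul, hadd, h _ _ (comp_mem 0 b), h _ _ (comp_mem 1 b)]

lemma tm_mul_of_odd {b c : Ubar r} (a d : Ubar r) (hb : b ∈ grading r 1)
    (hc : c ∈ grading r 1) : tm a b * tm c d = -tm (a * c) (b * d) := by
  have := GradedTensorProduct.tmul_coe_mul_coe_tmul (R := ℂ) (grading r) (grading r) a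
    ⟨b, hb⟩ ⟨c, hc⟩ d
  rw [mul_one, uzpow_one] at this
  simpa [Units.smul_def] using this

lemma tm_pow_of_even_left {b : Ubar r} (a : Ubar r) (hb : b ∈ grading r 0) (n : ℕ) :
    tm a b ^ n = tm (a ^ n) (b ^ n) := by
  induction n with
  | zero => simp only [pow_zero]; rfl
  | succ n ih => rw [pow_succ', ih, tm_mul_of_even_left _ _ hb, ← pow_succ', ← pow_succ']

lemma tm_pow_of_even_right {a : Ubar r} (b : Ubar r) (ha : a ∈ grading r 0) (n : ℕ) :
    tm a b ^ n = tm (a ^ n) (b ^ n) := by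
  induction n with
  | zero => simp only [pow_zero]; rfl
  | succ n ih => rw [pow_succ, ih, tm_mul_of_even_right _ _ ha, ← pow_succ, ← pow_succ]

lemma tm_zero_left (b : Ubar r) : tm 0 b = 0 := TensorProduct.zero_tmul _ b
lemma tm_zero_right (a : Ubar r) : tm a 0 = 0 := TensorProduct.tmul_zero _ a
lemma tm_one : (tm 1 1 : Sq r) = 1 := rfl

lemma comul_isRep (r : ℕ) [Fact (3 ≤ r)] [Fact (r ≠ 4)] :
    IsRep r (A := Sq r) (tm H 1 + tm 1 H) (tm K K) (tm Kinv Kinv) (tm 1 E + tm E K)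
      (tm Kinv F + tm F 1) where
  HK := by
    rw [add_mul, mul_add, tm_mul_of_even_right _ _ K_mem, tm_mul_of_even_right _ _ K_mem,
      tm_mul_of_even_left _ _ K_mem, tm_mul_of_even_left _ _ K_mem, HK]
    simp only [one_mul, mul_one]
  HKinv := by
    rw [add_mul, mul_add, tm_mul_of_even_right _ _ Kinv_mem, tm_mul_of_even_right _ _ Kinv_mem,
      tm_mul_of_even_left _ _ Kinv_mem, tm_mul_of_even_left _ _ Kinv_mem, HKinv]
    simp only [one_mul, mul_one]
  HE := by
    simp only [add_mul, mul_add]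
    rw [tm_mul_of_even_left _ _ one_mem, tm_mul_of_even_left _ _ H_mem,
      tm_mul_of_even_left _ _ one_mem, tm_mul_of_even_left _ _ H_mem,
      tm_mul_of_even_right _ _ H_mem, tm_mul_of_even_right _ _ one_mem,
      tm_mul_of_even_right _ _ H_mem, tm_mul_of_even_right _ _ one_mem, smul_add,
      ← tm_smul_left (2 : ℂ) E K, ← tm_smul_right (2 : ℂ) 1 E, ← HE, tm_sub_left, tm_sub_right, HK]
    simp only [one_mul, mul_one]
    abel
  HF := by
    simp only [add_mul, mul_add]
    rw [tm_mul_of_even_left _ _ one_mem, tm_mul_of_even_left _ _ H_mem,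
      tm_mul_of_even_left _ _ one_mem, tm_mul_of_even_left _ _ H_mem,
      tm_mul_of_even_right _ _ H_mem, tm_mul_of_even_right _ _ one_mem,
      tm_mul_of_even_right _ _ H_mem, tm_mul_of_even_right _ _ one_mem, smul_add,
      ← tm_smul_left (-2 : ℂ) F 1, ← tm_smul_right (-2 : ℂ) Kinv F, ← HF, tm_sub_left, tm_sub_right, HKinv]
    simp only [one_mul, mul_one]
    abel
  KKinv := by rw [tm_mul_of_even_left _ _ K_mem, KKinv, tm_one]
  KinvK := by rw [tm_mul_of_even_left _ _ Kinv_mem, KinvK, tm_one]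
  KE := by
    rw [add_mul, mul_add, tm_mul_of_even_left _ _ K_mem, tm_mul_of_even_left _ _ K_mem,
      tm_mul_of_even_right _ _ K_mem, tm_mul_of_even_right _ _ K_mem, KE, smul_add,
      tm_smul_left, tm_smul_right, one_mul, mul_one]
  KF := by
    rw [add_mul, mul_add, tm_mul_of_even_left _ _ K_mem, tm_mul_of_even_left _ _ K_mem,
      tm_mul_of_even_right _ _ K_mem, tm_mul_of_even_right _ _ K_mem, KF, smul_add,
      tm_smul_left, tm_smul_right, one_mul, mul_one, KKinv, KinvK]
  EF := by
    simp only [add_mul, mul_add]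
    rw [tm_mul_of_even_right _ _ Kinv_mem, tm_mul_of_even_left _ _ K_mem, tm_mul_of_odd _ _ E_mem F_mem,
      tm_mul_of_even_left _ _ K_mem, tm_mul_of_even_right _ _ one_mem,
      tm_mul_of_even_left _ _ one_mem, tm_mul_of_odd _ _ F_mem E_mem,
      tm_mul_of_even_left _ _ one_mem, EKinv, KF]
    have h1 : (tm Kinv (E * F) + tm Kinv (F * E) : Sq r) =
        (q r - (q r)⁻¹)⁻¹ • (tm Kinv K - tm Kinv Kinv) := by
      rw [← tm_add_right, EF, tm_smul_right, tm_sub_right]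
    have h2 : (tm (E * F) K + tm (F * E) K : Sq r) =
        (q r - (q r)⁻¹)⁻¹ • (tm K K - tm Kinv K) := by
      rw [← tm_add_left, EF, tm_smul_left, tm_sub_left]
    have h3 : (tm ((q r) ^ 2 • (Kinv * E)) (((q r)⁻¹) ^ 2 • (F * K)) : Sq r) =
        tm (Kinv * E) (F * K) := by
      rw [tm_smul_left, tm_smul_right, smul_smul, ← mul_pow, mul_inv_cancel₀ (q_ne_zero r),
        one_pow, one_smul]
    have h4 : (q r - (q r)⁻¹)⁻¹ • (tm K K - tm Kinv Kinv : Sq r) =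
        (q r - (q r)⁻¹)⁻¹ • (tm Kinv K - tm Kinv Kinv) +
        (q r - (q r)⁻¹)⁻¹ • (tm K K - tm Kinv K) := by
      rw [← smul_add]; congr 1; abel
    rw [h4, ← h1, ← h2, h3]
    simp only [one_mul, mul_one]
    abel
  E_pow := by
    apply add_pow_rbar_eq_zero
    · rw [tm_mul_of_even_left _ _ K_mem, tm_mul_of_odd _ _ E_mem E_mem, KE, tm_smul_right,
        one_mul, mul_one, neg_smul, smul_neg, neg_neg]
    · rw [tm_pow_of_even_right _ one_mem, E_pow, tm_zero_right]
    · rw [tm_pow_of_even_left _ K_mem, E_pow, tm_zero_left]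
  F_pow := by
    rw [add_comm]
    apply add_pow_rbar_eq_zero
    · rw [tm_mul_of_even_left _ _ one_mem, tm_mul_of_odd _ _ F_mem F_mem, FKinv, tm_smul_left,
        one_mul, mul_one, neg_smul, smul_smul, ← mul_pow,
        mul_inv_cancel₀ (q_ne_zero r), one_pow, one_smul]
    · rw [tm_pow_of_even_left _ one_mem, F_pow, tm_zero_left]
    · rw [tm_pow_of_even_right _ Kinv_mem, F_pow, tm_zero_right]

/-- The coproduct: `Δ(H) = H ⊗ 1 + 1 ⊗ H`, `Δ(K) = K ⊗ K`, `Δ(E) = 1 ⊗ E + E ⊗ K`,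
`Δ(F) = K⁻¹ ⊗ F + F ⊗ 1`. -/
noncomputable def comul (r : ℕ) [Fact (3 ≤ r)] [Fact (r ≠ 4)] : Ubar r →ₐ[ℂ] Sq r :=
  lift (tm H 1 + tm 1 H) (tm K K) (tm Kinv Kinv) (tm 1 E + tm E K) (tm Kinv F + tm F 1)
    (comul_isRep r)

/-- The counit: `ε(K) = 1`, `ε(H) = ε(E) = ε(F) = 0`. -/
noncomputable def counit (r : ℕ) [Fact (3 ≤ r)] : Ubar r →ₐ[ℂ] ℂ :=
  lift 0 1 1 0 0
    { HK := by simp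
      HKinv := by simp
      HE := by simp
      HF := by simp
      KKinv := by simp
      KinvK := by simp
      KE := by simp
      KF := by simp
      EF := by simp
      E_pow := zero_pow (rbar_pos r).ne'
      F_pow := zero_pow (rbar_pos r).ne' }

end Ubar

/-! ### Weight modules -/

/-- A finite dimensional weight module over the restricted unrolled quantum group: a finite
dimensional super vector space `V = V₀ ⊕ V₁` with an even action of the superalgebra, such that
`H` is diagonalizable and `K v = q ^ μ v` whenever `H v = μ v`. -/
structure WeightModule (r : ℕ) where
  carrier : Type
  [addCommGroup : AddCommGroup carrier]
  [module : Module ℂ carrier]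
  [finiteDimensional : FiniteDimensional ℂ carrier]
  /-- The action of the algebra. -/
  ρ : Ubar r →ₐ[ℂ] Module.End ℂ carrier
  /-- The even part (`0`) and the odd part (`1`). -/
  grading : ZMod 2 → Submodule ℂ carrier
  isCompl : IsCompl (grading 0) (grading 1)
  ρ_mem : ∀ i j : ZMod 2, ∀ a ∈ Ubar.grading r i, ∀ v ∈ grading j, ρ a v ∈ grading (i + j)
  iSup_eigenspace : ⨆ μ : ℂ, (ρ Ubar.H).eigenspace μ = ⊤
  K_apply : ∀ (μ : ℂ) (v : carrier), ρ Ubar.H v = μ • v → ρ Ubar.K v = qpow r μ • v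

attribute [instance] WeightModule.addCommGroup WeightModule.module
  WeightModule.finiteDimensional

lemma eq_zero_of_add_self {X : Type*} [AddCommGroup X] [Module ℂ X] {x : X} (h : x + x = 0) :
    x = 0 := by
  rw [← two_smul ℂ x] at h
  exact (smul_eq_zero.1 h).resolve_left two_ne_zero

lemma isCompl_of_involution {X : Type*} [AddCommGroup X] [Module ℂ X] (T : Module.End ℂ X)
    (G : ZMod 2 → Submodule ℂ X) (h0 : ∀ x ∈ G 0, T x = x) (h1 : ∀ x ∈ G 1, T x = -x)
    (hsup : G 0 ⊔ G 1 = ⊤) : IsCompl (G 0) (G 1) := by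
  refine ⟨?_, codisjoint_iff.2 hsup⟩
  rw [Submodule.disjoint_def]
  intro x hx0 hx1
  have h : x = -x := by rw [← h1 x hx1, h0 x hx0]
  exact eq_zero_of_add_self (by nth_rewrite 2 [h]; exact add_neg_cancel x)

namespace WeightModule

variable {r : ℕ}

lemma isCompl' (V : WeightModule r) (i : ZMod 2) : IsCompl (V.grading i) (V.grading (i + 1)) := by
  fin_cases i
  · exact V.isCompl
  · exact V.isCompl.symm

/-- The projection onto the component of parity `i`. -/
noncomputable def proj (V : WeightModule r) (i : ZMod 2) : Module.End ℂ V.carrier :=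
  (V.grading i).projection (V.grading (i + 1)) (V.isCompl' i)

/-- The operator `v ↦ (-1)^|v| v`. -/
noncomputable def par (V : WeightModule r) : Module.End ℂ V.carrier := V.proj 0 - V.proj 1

section

variable (V W : WeightModule r)

lemma proj_of_mem {i : ZMod 2} {v : V.carrier} (h : v ∈ V.grading i) : V.proj i v = v :=
  Submodule.projection_apply_of_mem_left _ h

lemma proj_of_mem_ne {i j : ZMod 2} (hij : j ≠ i) {v : V.carrier} (h : v ∈ V.grading j) :
    V.proj i v = 0 := by
  have hj : j = i + 1 := by
    clear h
    revert i j
    decide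
  subst hj
  exact (Submodule.projection_apply_eq_zero_iff (V.isCompl' i)).2 h

lemma proj_mem (i : ZMod 2) (v : V.carrier) : V.proj i v ∈ V.grading i :=
  Submodule.projection_apply_mem (V.isCompl' i) v

lemma proj_add_proj (v : V.carrier) : V.proj 0 v + V.proj 1 v = v :=
  Submodule.projection_add_projection_eq_self V.isCompl v

lemma par_apply (v : V.carrier) : V.par v = V.proj 0 v - V.proj 1 v := rfl

lemma par_of_mem_zero {v : V.carrier} (h : v ∈ V.grading 0) : V.par v = v := by
  rw [par_apply, V.proj_of_mem h, V.proj_of_mem_ne (by decide) h, sub_zero]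

lemma par_of_mem_one {v : V.carrier} (h : v ∈ V.grading 1) : V.par v = -v := by
  rw [par_apply, V.proj_of_mem h, V.proj_of_mem_ne (by decide) h, zero_sub]

lemma par_of_mem {i : ZMod 2} {v : V.carrier} (h : v ∈ V.grading i) :
    V.par v = ((-1 : ℤˣ) ^ i) • v := by
  fin_cases i
  · change _ = ((-1 : ℤˣ) ^ (0 : ZMod 2)) • v
    rw [uzpow_zero, one_smul, V.par_of_mem_zero h]
  · change _ = ((-1 : ℤˣ) ^ (1 : ZMod 2)) • v
    rw [uzpow_one, V.par_of_mem_one h]; simp [Units.smul_def]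

lemma mem_zero_iff {v : V.carrier} : v ∈ V.grading 0 ↔ V.par v = v := by
  refine ⟨V.par_of_mem_zero, fun h => ?_⟩
  have h2 := V.proj_add_proj v
  have h3 : V.proj 1 v = 0 := by
    rw [par_apply, ← sub_eq_zero] at h
    nth_rewrite 3 [← h2] at h
    rw [sub_add_eq_sub_sub, sub_sub_cancel_left, ← neg_add', neg_eq_zero] at h
    exact eq_zero_of_add_self h
  rw [← h2, h3, add_zero]
  exact V.proj_mem 0 v

lemma mem_one_iff {v : V.carrier} : v ∈ V.grading 1 ↔ V.par v = -v := by
  refine ⟨V.par_of_mem_one, fun h => ?_⟩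
  have h2 := V.proj_add_proj v
  have h3 : V.proj 0 v = 0 := by
    rw [par_apply, eq_neg_iff_add_eq_zero] at h
    nth_rewrite 3 [← h2] at h
    refine eq_zero_of_add_self ?_
    rw [← h]
    abel
  rw [← h2, h3, zero_add]
  exact V.proj_mem 1 v

lemma mem_iff {i : ZMod 2} {v : V.carrier} :
    v ∈ V.grading i ↔ V.par v = ((-1 : ℤˣ) ^ i) • v := by
  refine ⟨V.par_of_mem, fun h => ?_⟩
  fin_cases i
  · change _ = ((-1 : ℤˣ) ^ (0 : ZMod 2)) • v at h
    rw [uzpow_zero, one_smul] at h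
    exact V.mem_zero_iff.2 h
  · change _ = ((-1 : ℤˣ) ^ (1 : ZMod 2)) • v at h
    rw [uzpow_one] at h
    exact V.mem_one_iff.2 (by simpa [Units.smul_def] using h)

lemma par_par : V.par * V.par = 1 := by
  ext v
  rw [Module.End.mul_apply, Module.End.one_apply]
  conv_rhs => rw [← V.proj_add_proj v]
  rw [par_apply V v, map_sub, V.par_of_mem_zero (V.proj_mem 0 v),
    V.par_of_mem_one (V.proj_mem 1 v), sub_neg_eq_add]

lemma par_ρ_of_mem {i : ZMod 2} {a : Ubar r} (ha : a ∈ Ubar.grading r i) :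
    V.par * V.ρ a = ((-1 : ℤˣ) ^ i) • (V.ρ a * V.par) := by
  have key : ∀ j, ∀ v ∈ V.grading j, V.par (V.ρ a v) = ((-1 : ℤˣ) ^ i) • V.ρ a (V.par v) := by
    intro j v hv
    rw [V.par_of_mem (V.ρ_mem i j a ha v hv), V.par_of_mem hv, uzpow_add, mul_smul,
      map_zsmul_unit]
  ext v
  rw [Module.End.mul_apply]
  change _ = ((-1 : ℤˣ) ^ i) • (V.ρ a (V.par v))
  rw [← V.proj_add_proj v, map_add, map_add, map_add, map_add, smul_add,
    key 0 _ (V.proj_mem 0 v), key 1 _ (V.proj_mem 1 v)]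

lemma par_ρ_even {a : Ubar r} (ha : a ∈ Ubar.grading r 0) : V.par * V.ρ a = V.ρ a * V.par := by
  rw [V.par_ρ_of_mem ha, uzpow_zero, one_smul]

lemma par_ρ_odd {a : Ubar r} (ha : a ∈ Ubar.grading r 1) : V.par * V.ρ a = -(V.ρ a * V.par) := by
  rw [V.par_ρ_of_mem ha, uzpow_one]; simp [Units.smul_def]

/-! ### The action of the tensor square of the superalgebra on `V ⊗ W` -/

/-- The action of `a ⊗ 1` on `V ⊗ W`. -/
noncomputable def actLeft : Ubar r →ₐ[ℂ] Module.End ℂ (V.carrier ⊗[ℂ] W.carrier) :=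
  AlgHom.ofLinearMap
    { toFun := fun a => TensorProduct.map (V.ρ a) 1
      map_add' := fun a b => by rw [map_add, TensorProduct.map_add_left]
      map_smul' := fun c a => by rw [map_smul, TensorProduct.map_smul_left]; rfl }
    (by
      change TensorProduct.map (V.ρ 1) 1 = 1
      rw [map_one]; exact TensorProduct.map_one)
    (fun a b => by
      change TensorProduct.map (V.ρ (a * b)) 1 =
        TensorProduct.map (V.ρ a) 1 * TensorProduct.map (V.ρ b) 1
      rw [map_mul, ← TensorProduct.map_mul, one_mul])

/-- The action of `1 ⊗ b` on `V ⊗ W`: `v ⊗ w ↦ (-1)^(|b| |v|) v ⊗ b w`. -/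
noncomputable def actRight : Ubar r →ₐ[ℂ] Module.End ℂ (V.carrier ⊗[ℂ] W.carrier) :=
  AlgHom.ofLinearMap
    { toFun := fun b => TensorProduct.map 1 (W.ρ (Ubar.comp 0 b)) +
        TensorProduct.map V.par (W.ρ (Ubar.comp 1 b))
      map_add' := fun a b => by
        have h : ∀ i, Ubar.comp i (a + b) = Ubar.comp i a + Ubar.comp i b := fun i => by
          simp only [Ubar.comp, map_add, smul_add]; abel
        rw [h, h, map_add, map_add, TensorProduct.map_add_right, TensorProduct.map_add_right]
        abel
      map_smul' := fun c a => by
        have h : ∀ i, Ubar.comp i (c • a) = c • Ubar.comp i a := fun i => by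
          simp only [Ubar.comp, map_smul]
          rw [smul_comm ((-1 : ℤˣ) ^ i), ← smul_add, smul_comm]
        rw [h, h, map_smul, map_smul, TensorProduct.map_smul_right, TensorProduct.map_smul_right,
          ← smul_add]
        rfl }
    (by
      change TensorProduct.map 1 (W.ρ (Ubar.comp 0 1)) +
        TensorProduct.map V.par (W.ρ (Ubar.comp 1 1)) = 1
      rw [Ubar.comp_zero_of_mem_zero Ubar.one_mem, Ubar.comp_one_of_mem_zero Ubar.one_mem, map_one,
        map_zero, TensorProduct.map_zero_right, add_zero]
      exact TensorProduct.map_one)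
    (fun a b => by
      change TensorProduct.map 1 (W.ρ (Ubar.comp 0 (a * b))) +
        TensorProduct.map V.par (W.ρ (Ubar.comp 1 (a * b))) =
        (TensorProduct.map 1 (W.ρ (Ubar.comp 0 a)) + TensorProduct.map V.par (W.ρ (Ubar.comp 1 a))) *
        (TensorProduct.map 1 (W.ρ (Ubar.comp 0 b)) + TensorProduct.map V.par (W.ρ (Ubar.comp 1 b)))
      have hab : a * b = (Ubar.comp 0 a + Ubar.comp 1 a) * (Ubar.comp 0 b + Ubar.comp 1 b) := by
        rw [Ubar.comp_add_comp, Ubar.comp_add_comp]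
      have h0 : Ubar.comp 0 (a * b) =
          Ubar.comp 0 a * Ubar.comp 0 b + Ubar.comp 1 a * Ubar.comp 1 b := by
        simp only [Ubar.comp_zero, Ubar.comp_one, map_mul, smul_mul_smul_comm, ← smul_add,
          mul_add, add_mul, mul_sub, sub_mul]
        module
      have h1 : Ubar.comp 1 (a * b) =
          Ubar.comp 0 a * Ubar.comp 1 b + Ubar.comp 1 a * Ubar.comp 0 b := by
        simp only [Ubar.comp_zero, Ubar.comp_one, map_mul, smul_mul_smul_comm, ← smul_add,
          mul_add, add_mul, mul_sub, sub_mul]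
        module
      rw [h0, h1, add_mul, mul_add, mul_add, ← TensorProduct.map_mul, ← TensorProduct.map_mul,
        ← TensorProduct.map_mul, ← TensorProduct.map_mul, V.par_par, map_add, map_add,
        TensorProduct.map_add_right, TensorProduct.map_add_right, map_mul, map_mul, map_mul,
        map_mul, one_mul, one_mul, mul_one]
      abel)

lemma actLeft_apply (a : Ubar r) : actLeft V W a = TensorProduct.map (V.ρ a) 1 := rfl

lemma actRight_of_even {b : Ubar r} (hb : b ∈ Ubar.grading r 0) :
    actRight V W b = TensorProduct.map 1 (W.ρ b) := by
  change TensorProduct.map 1 (W.ρ (Ubar.comp 0 b)) +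
        TensorProduct.map V.par (W.ρ (Ubar.comp 1 b)) = _
  rw [Ubar.comp_zero_of_mem_zero hb, Ubar.comp_one_of_mem_zero hb,
        map_zero, TensorProduct.map_zero_right, add_zero]

lemma actRight_of_odd {b : Ubar r} (hb : b ∈ Ubar.grading r 1) :
    actRight V W b = TensorProduct.map V.par (W.ρ b) := by
  change TensorProduct.map 1 (W.ρ (Ubar.comp 0 b)) +
        TensorProduct.map V.par (W.ρ (Ubar.comp 1 b)) = _
  rw [Ubar.comp_zero_of_mem_one hb, Ubar.comp_one_of_mem_one hb,
        map_zero, TensorProduct.map_zero_right, zero_add]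

/-- The action of the tensor square of the superalgebra on `V ⊗ W` with Koszul signs. -/
noncomputable def act : Ubar.Sq r →ₐ[ℂ] Module.End ℂ (V.carrier ⊗[ℂ] W.carrier) :=
  GradedTensorProduct.lift (Ubar.grading r) (Ubar.grading r) (actLeft V W) (actRight V W) (by
    rintro i j ⟨a, ha⟩ ⟨b, hb⟩
    fin_cases j
    · change b ∈ Ubar.grading r 0 at hb
      change _ = (-1 : ℤˣ) ^ (0 * i) • _
      rw [zero_mul, uzpow_zero, one_smul, actLeft_apply, actRight_of_even V W hb,
        ← TensorProduct.map_mul, ← TensorProduct.map_mul, one_mul, one_mul, mul_one, mul_one]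
    · change b ∈ Ubar.grading r 1 at hb
      change _ = (-1 : ℤˣ) ^ (1 * i) • _
      rw [one_mul, actLeft_apply, actRight_of_odd V W hb,
        ← TensorProduct.map_mul, ← TensorProduct.map_mul, one_mul, mul_one, V.par_ρ_of_mem ha]
      have h2 : ∀ (u : ℤˣ) (f : Module.End ℂ V.carrier) (g : Module.End ℂ W.carrier),
          u • TensorProduct.map (u • f) g = TensorProduct.map f g := by
        intro u f g
        rcases Int.units_eq_one_or u with rfl | rfl
        · simp
        · rw [Units.smul_def, Units.smul_def]
          simp only [Units.val_neg, Units.val_one, neg_smul, one_smul]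
          ext v w
          change -((-(f v)) ⊗ₜ[ℂ] g w) = f v ⊗ₜ[ℂ] g w
          rw [TensorProduct.neg_tmul, neg_neg]
      exact (h2 _ _ _).symm)

lemma act_tm (a b : Ubar r) : act V W (Ubar.tm a b) = actLeft V W a * actRight V W b := rfl

/-- The Koszul sign rule `(a ⊗ b) (v ⊗ w) = (-1)^(|b| |v|) a v ⊗ b w`. -/
lemma act_tm_apply (a : Ubar r) {i j : ZMod 2} {b : Ubar r} (hb : b ∈ Ubar.grading r j)
    {v : V.carrier} (hv : v ∈ V.grading i) (w : W.carrier) :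
    act V W (Ubar.tm a b) (v ⊗ₜ w) = ((-1 : ℤˣ) ^ (j * i)) • (V.ρ a v ⊗ₜ[ℂ] W.ρ b w) := by
  rw [act_tm, actLeft_apply]
  fin_cases j
  · change b ∈ Ubar.grading r 0 at hb
    change _ = (-1 : ℤˣ) ^ (0 * i) • _
    rw [actRight_of_even V W hb, zero_mul, uzpow_zero, one_smul]
    rfl
  · change b ∈ Ubar.grading r 1 at hb
    change _ = (-1 : ℤˣ) ^ (1 * i) • _
    rw [actRight_of_odd V W hb, one_mul]
    change V.ρ a (V.par v) ⊗ₜ[ℂ] W.ρ b w = _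
    rw [V.par_of_mem hv]
    rcases Int.units_eq_one_or ((-1 : ℤˣ) ^ i) with h | h <;> rw [h]
    · simp
    · simp [Units.smul_def, TensorProduct.neg_tmul]

end

end WeightModule

/-! ### The tensor product of weight modules -/

lemma weight_of_iSup_eq_top {X : Type*} [AddCommGroup X] [Module ℂ X] (h k : Module.End ℂ X)
    (χ : ℂ → ℂ) (hsup : ⨆ μ : ℂ, h.eigenspace μ ⊓ k.eigenspace (χ μ) = ⊤) :
    (⨆ μ : ℂ, h.eigenspace μ = ⊤) ∧ ∀ (μ : ℂ) (x : X), h x = μ • x → k x = χ μ • x := by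
  refine ⟨top_le_iff.1 (hsup ▸ iSup_mono fun μ => inf_le_left), ?_⟩
  intro μ x hx
  have hx' : x ∈ h.eigenspace μ := Module.End.mem_eigenspace_iff.2 hx
  suffices hle : h.eigenspace μ ≤ h.eigenspace μ ⊓ k.eigenspace (χ μ) from
    Module.End.mem_eigenspace_iff.1 (hle hx').2
  have hdis : Disjoint (h.eigenspace μ) (⨆ ν, ⨆ _ : ν ≠ μ, h.eigenspace ν) :=
    h.eigenspaces_iSupIndep μ
  have htop : (h.eigenspace μ ⊓ k.eigenspace (χ μ)) ⊔
      (⨆ ν, ⨆ _ : ν ≠ μ, h.eigenspace ν) = ⊤ := by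
    rw [← top_le_iff, ← hsup]
    refine iSup_le fun ν => ?_
    by_cases hν : ν = μ
    · subst hν; exact le_sup_left
    · exact le_sup_of_le_right (le_iSup₂_of_le ν hν inf_le_left)
  calc h.eigenspace μ = ((h.eigenspace μ ⊓ k.eigenspace (χ μ)) ⊔
      (⨆ ν, ⨆ _ : ν ≠ μ, h.eigenspace ν)) ⊓ h.eigenspace μ := by rw [htop, top_inf_eq]
    _ = (h.eigenspace μ ⊓ k.eigenspace (χ μ)) ⊔
      ((⨆ ν, ⨆ _ : ν ≠ μ, h.eigenspace ν) ⊓ h.eigenspace μ) := sup_inf_assoc_of_le _ inf_le_left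
    _ ≤ _ := by rw [hdis.symm.eq_bot, sup_bot_eq]

lemma iSup_map₂_eq_top {ι κ X Y : Type*} [AddCommGroup X] [Module ℂ X] [AddCommGroup Y]
    [Module ℂ Y] (p : ι → Submodule ℂ X) (p' : κ → Submodule ℂ Y) (hp : ⨆ i, p i = ⊤)
    (hp' : ⨆ i, p' i = ⊤) : ⨆ i, ⨆ j, Submodule.map₂ (TensorProduct.mk ℂ X Y) (p i) (p' j) = ⊤ := by
  rw [← TensorProduct.map₂_mk_top_top_eq_top, ← hp, ← hp', Submodule.map₂_iSup_left]
  simp_rw [Submodule.map₂_iSup_right]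

lemma map_neg_left' {X Y : Type*} [AddCommGroup X] [Module ℂ X] [AddCommGroup Y] [Module ℂ Y]
    (f : Module.End ℂ X) (g : Module.End ℂ Y) :
    TensorProduct.map (-f) g = -TensorProduct.map f g := by
  ext v w
  exact TensorProduct.neg_tmul (f v) (g w)

lemma map_neg_right' {X Y : Type*} [AddCommGroup X] [Module ℂ X] [AddCommGroup Y] [Module ℂ Y]
    (f : Module.End ℂ X) (g : Module.End ℂ Y) :
    TensorProduct.map f (-g) = -TensorProduct.map f g := by
  ext v w
  exact TensorProduct.tmul_neg (f v) (g w)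

namespace WeightModule

section

variable {r : ℕ} (V W : WeightModule r)

/-- The grading `(V ⊗ W)_p = ⨁_{a + b = p} V_a ⊗ W_b`. -/
def tensorGrading (p : ZMod 2) : Submodule ℂ (V.carrier ⊗[ℂ] W.carrier) :=
  ⨆ (a : ZMod 2) (b : ZMod 2) (_ : a + b = p),
    Submodule.map₂ (TensorProduct.mk ℂ V.carrier W.carrier) (V.grading a) (W.grading b)

lemma mem_tensorGrading {a b p : ZMod 2} (h : a + b = p) {v : V.carrier} {w : W.carrier}
    (hv : v ∈ V.grading a) (hw : w ∈ W.grading b) : v ⊗ₜ[ℂ] w ∈ tensorGrading V W p :=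
  (le_iSup₂_of_le a b (le_iSup_of_le h le_rfl) :
    Submodule.map₂ (TensorProduct.mk ℂ V.carrier W.carrier) (V.grading a) (W.grading b) ≤
      tensorGrading V W p) (Submodule.apply_mem_map₂ _ hv hw)

lemma tensorGrading_le {p : ZMod 2} {S : Submodule ℂ (V.carrier ⊗[ℂ] W.carrier)}
    (h : ∀ a b : ZMod 2, a + b = p → ∀ v ∈ V.grading a, ∀ w ∈ W.grading b, v ⊗ₜ[ℂ] w ∈ S) :
    tensorGrading V W p ≤ S :=
  iSup₂_le fun a b => iSup_le fun hab => Submodule.map₂_le.2 fun v hv w hw => h a b hab v hv w hw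

lemma map_par_of_mem {p : ZMod 2} {x : V.carrier ⊗[ℂ] W.carrier}
    (hx : x ∈ tensorGrading V W p) :
    TensorProduct.map V.par W.par x = ((-1 : ℤˣ) ^ p) • x := by
  let S : Submodule ℂ (V.carrier ⊗[ℂ] W.carrier) :=
    LinearMap.eqLocus (TensorProduct.map V.par W.par)
      (((((-1 : ℤˣ) ^ p : ℤˣ) : ℤ) : ℂ) • LinearMap.id)
  have hS : ∀ y, y ∈ S ↔ TensorProduct.map V.par W.par y = ((-1 : ℤˣ) ^ p) • y := by
    intro y
    rw [LinearMap.mem_eqLocus, Units.smul_def, ← Int.cast_smul_eq_zsmul ℂ]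
    rfl
  rw [← hS]
  refine tensorGrading_le V W (S := S) ?_ hx
  rintro a b rfl v hv w hw
  rw [hS, TensorProduct.map_tmul, V.par_of_mem hv, W.par_of_mem hw, uzpow_add]
  rcases Int.units_eq_one_or ((-1 : ℤˣ) ^ a) with ha | ha <;>
  rcases Int.units_eq_one_or ((-1 : ℤˣ) ^ b) with hb | hb <;> rw [ha, hb] <;>
    simp [Units.smul_def, TensorProduct.neg_tmul, TensorProduct.tmul_neg]

lemma tensorGrading_sup : tensorGrading V W 0 ⊔ tensorGrading V W 1 = ⊤ := by
  have hV : ∀ U : WeightModule r, ⨆ i : ZMod 2, U.grading i = ⊤ := fun U => by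
    rw [← top_le_iff, ← U.isCompl.sup_eq_top]
    exact sup_le (le_iSup U.grading 0) (le_iSup U.grading 1)
  rw [← top_le_iff, ← iSup_map₂_eq_top _ _ (hV V) (hV W)]
  refine iSup₂_le fun a b => Submodule.map₂_le.2 fun v hv w hw => ?_
  have h01 : ∀ p : ZMod 2, p = 0 ∨ p = 1 := by decide
  rcases h01 (a + b) with h | h
  · exact Submodule.mem_sup_left (mem_tensorGrading V W h hv hw)
  · exact Submodule.mem_sup_right (mem_tensorGrading V W h hv hw)

lemma tensorGrading_isCompl : IsCompl (tensorGrading V W 0) (tensorGrading V W 1) := by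
  refine isCompl_of_involution (TensorProduct.map V.par W.par) _ ?_ ?_ (tensorGrading_sup V W)
  · intro x hx
    rw [map_par_of_mem V W hx, uzpow_zero, one_smul]
  · intro x hx
    rw [map_par_of_mem V W hx, uzpow_one]; simp [Units.smul_def]

lemma mem_tensorGrading_iff {p : ZMod 2} {x : V.carrier ⊗[ℂ] W.carrier} :
    x ∈ tensorGrading V W p ↔ TensorProduct.map V.par W.par x = ((-1 : ℤˣ) ^ p) • x := by
  refine ⟨map_par_of_mem V W, fun h => ?_⟩
  have hx : x ∈ tensorGrading V W 0 ⊔ tensorGrading V W 1 := by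
    rw [tensorGrading_sup]; trivial
  obtain ⟨y, hy, z, hz, rfl⟩ := Submodule.mem_sup.1 hx
  rw [map_add, map_par_of_mem V W hy, map_par_of_mem V W hz, uzpow_zero, uzpow_one, one_smul] at h
  have hneg : ∀ u : V.carrier ⊗[ℂ] W.carrier, (-1 : ℤˣ) • u = -u := fun u => by
    simp [Units.smul_def]
  fin_cases p
  · change _ = ((-1 : ℤˣ) ^ (0 : ZMod 2)) • (y + z) at h
    change y + z ∈ tensorGrading V W 0
    rw [uzpow_zero, one_smul, hneg] at h
    have hz0 : z = 0 := eq_zero_of_add_self (by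
      have := add_left_cancel h
      nth_rewrite 1 [← this]; exact neg_add_cancel z)
    rw [hz0, add_zero]; exact hy
  · change _ = ((-1 : ℤˣ) ^ (1 : ZMod 2)) • (y + z) at h
    change y + z ∈ tensorGrading V W 1
    rw [uzpow_one, hneg, hneg, neg_add] at h
    have hy0 : y = 0 := eq_zero_of_add_self (by
      have := add_right_cancel h
      nth_rewrite 1 [this]; exact neg_add_cancel y)
    rw [hy0, zero_add]; exact hz

variable [Fact (3 ≤ r)] [Fact (r ≠ 4)]

/-- The action of the algebra on `V ⊗ W` through the coproduct. -/
noncomputable def tensorρ : Ubar r →ₐ[ℂ] Module.End ℂ (V.carrier ⊗[ℂ] W.carrier) :=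
  (act V W).comp (Ubar.comul r)

lemma tensorρ_H : tensorρ V W Ubar.H =
    TensorProduct.map (V.ρ Ubar.H) 1 + TensorProduct.map 1 (W.ρ Ubar.H) := by
  rw [tensorρ, AlgHom.comp_apply, Ubar.comul, Ubar.lift_H, map_add, act_tm, act_tm,
    actRight_of_even V W Ubar.H_mem, map_one, map_one, mul_one, one_mul, actLeft_apply]

lemma tensorρ_K : tensorρ V W Ubar.K = TensorProduct.map (V.ρ Ubar.K) (W.ρ Ubar.K) := by
  rw [tensorρ, AlgHom.comp_apply, Ubar.comul, Ubar.lift_K, act_tm,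
    actRight_of_even V W Ubar.K_mem, actLeft_apply, ← TensorProduct.map_mul, one_mul, mul_one]

lemma tensorρ_Kinv :
    tensorρ V W Ubar.Kinv = TensorProduct.map (V.ρ Ubar.Kinv) (W.ρ Ubar.Kinv) := by
  rw [tensorρ, AlgHom.comp_apply, Ubar.comul, Ubar.lift_Kinv, act_tm,
    actRight_of_even V W Ubar.Kinv_mem, actLeft_apply, ← TensorProduct.map_mul, one_mul, mul_one]

lemma tensorρ_E : tensorρ V W Ubar.E =
    TensorProduct.map V.par (W.ρ Ubar.E) + TensorProduct.map (V.ρ Ubar.E) (W.ρ Ubar.K) := by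
  rw [tensorρ, AlgHom.comp_apply, Ubar.comul, Ubar.lift_E, map_add, act_tm, act_tm,
    actRight_of_even V W Ubar.K_mem, actRight_of_odd V W Ubar.E_mem, map_one, one_mul,
    actLeft_apply, ← TensorProduct.map_mul, one_mul, mul_one]

lemma tensorρ_F : tensorρ V W Ubar.F =
    TensorProduct.map (V.ρ Ubar.Kinv * V.par) (W.ρ Ubar.F) +
      TensorProduct.map (V.ρ Ubar.F) 1 := by
  rw [tensorρ, AlgHom.comp_apply, Ubar.comul, Ubar.lift_F, map_add, act_tm, act_tm, map_one,
    mul_one, actRight_of_odd V W Ubar.F_mem, actLeft_apply, actLeft_apply,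
    ← TensorProduct.map_mul, one_mul]

lemma map_par_tensorρ (a : Ubar r) : TensorProduct.map V.par W.par * tensorρ V W a =
    tensorρ V W (Ubar.parity r a) * TensorProduct.map V.par W.par := by
  induction a using Ubar.induction with
  | halg c =>
    rw [AlgHom.commutes, AlgHom.commutes, AlgHom.commutes]
    exact (Algebra.commutes c (TensorProduct.map V.par W.par)).symm
  | hH =>
    rw [Ubar.parity_H, tensorρ_H, mul_add, add_mul]
    simp only [← TensorProduct.map_mul, mul_one, one_mul, V.par_ρ_even Ubar.H_mem,
      W.par_ρ_even Ubar.H_mem]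
  | hK =>
    rw [Ubar.parity_K, tensorρ_K]
    simp only [← TensorProduct.map_mul, V.par_ρ_even Ubar.K_mem, W.par_ρ_even Ubar.K_mem]
  | hKinv =>
    rw [Ubar.parity_Kinv, tensorρ_Kinv]
    simp only [← TensorProduct.map_mul, V.par_ρ_even Ubar.Kinv_mem, W.par_ρ_even Ubar.Kinv_mem]
  | hE =>
    have hn : tensorρ V W (-Ubar.E) * TensorProduct.map V.par W.par =
        -(tensorρ V W Ubar.E * TensorProduct.map V.par W.par) := by rw [map_neg]; rfl
    rw [Ubar.parity_E, hn, tensorρ_E, mul_add, add_mul]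
    simp only [← TensorProduct.map_mul, V.par_ρ_odd Ubar.E_mem, W.par_ρ_odd Ubar.E_mem,
      W.par_ρ_even Ubar.K_mem, map_neg_left', map_neg_right']
    abel
  | hF =>
    have hn : tensorρ V W (-Ubar.F) * TensorProduct.map V.par W.par =
        -(tensorρ V W Ubar.F * TensorProduct.map V.par W.par) := by rw [map_neg]; rfl
    rw [Ubar.parity_F, hn, tensorρ_F, mul_add, add_mul]
    simp only [← TensorProduct.map_mul, ← mul_assoc, V.par_ρ_odd Ubar.F_mem,
      W.par_ρ_odd Ubar.F_mem, V.par_ρ_even Ubar.Kinv_mem, mul_one, one_mul, map_neg_left',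
      map_neg_right']
    abel
  | hadd a b ha hb => rw [map_add, map_add, map_add, mul_add, add_mul, ha, hb]
  | hmul a b ha hb => rw [map_mul, map_mul, map_mul, ← mul_assoc, ha, mul_assoc, hb, mul_assoc]

lemma tensorρ_mem (i j : ZMod 2) (a : Ubar r) (ha : a ∈ Ubar.grading r i)
    (x : V.carrier ⊗[ℂ] W.carrier) (hx : x ∈ tensorGrading V W j) :
    tensorρ V W a x ∈ tensorGrading V W (i + j) := by
  rw [mem_tensorGrading_iff] at hx ⊢
  have h := LinearMap.congr_fun (map_par_tensorρ V W a) x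
  rw [Module.End.mul_apply, Module.End.mul_apply, hx, Ubar.mem_grading.1 ha] at h
  rw [h, uzpow_add, mul_smul, map_zsmul_unit, map_zsmul_unit, smul_comm]
  rfl

lemma tensor_weight :
    (⨆ μ : ℂ, (tensorρ V W Ubar.H).eigenspace μ = ⊤) ∧
      ∀ (μ : ℂ) (x : V.carrier ⊗[ℂ] W.carrier), tensorρ V W Ubar.H x = μ • x →
        tensorρ V W Ubar.K x = qpow r μ • x := by
  refine weight_of_iSup_eq_top _ _ (qpow r) ?_
  rw [← top_le_iff, ← iSup_map₂_eq_top _ _ V.iSup_eigenspace W.iSup_eigenspace]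
  refine iSup₂_le fun μ ν => le_iSup_of_le (μ + ν) (Submodule.map₂_le.2 fun v hv w hw => ?_)
  rw [Module.End.mem_eigenspace_iff] at hv hw
  refine ⟨?_, ?_⟩
  · change _ ∈ Module.End.eigenspace _ _
    rw [Module.End.mem_eigenspace_iff, tensorρ_H]
    change V.ρ Ubar.H v ⊗ₜ[ℂ] w + v ⊗ₜ[ℂ] W.ρ Ubar.H w = (μ + ν) • (v ⊗ₜ[ℂ] w)
    rw [hv, hw, add_smul, TensorProduct.smul_tmul', TensorProduct.tmul_smul]
  · change _ ∈ Module.End.eigenspace _ _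
    rw [Module.End.mem_eigenspace_iff, tensorρ_K]
    change V.ρ Ubar.K v ⊗ₜ[ℂ] W.ρ Ubar.K w = qpow r (μ + ν) • (v ⊗ₜ[ℂ] w)
    rw [V.K_apply _ _ hv, W.K_apply _ _ hw, TensorProduct.smul_tmul_smul, qpow_add]

/-- The tensor product of weight modules. -/
noncomputable def tensor : WeightModule r where
  carrier := V.carrier ⊗[ℂ] W.carrier
  ρ := tensorρ V W
  grading := tensorGrading V W
  isCompl := tensorGrading_isCompl V W
  ρ_mem := tensorρ_mem V W
  iSup_eigenspace := (tensor_weight V W).1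
  K_apply := (tensor_weight V W).2

lemma tensor_par : (tensor V W).par = TensorProduct.map V.par W.par := by
  refine LinearMap.ext fun x => ?_
  let y : V.carrier ⊗[ℂ] W.carrier := (tensor V W).proj 0 x
  let z : V.carrier ⊗[ℂ] W.carrier := (tensor V W).proj 1 x
  have h0 : TensorProduct.map V.par W.par y = y := by
    have hy : y ∈ tensorGrading V W 0 := (tensor V W).proj_mem 0 x
    rw [map_par_of_mem V W hy, uzpow_zero, one_smul]
  have h1 : TensorProduct.map V.par W.par z = -z := by
    have hz : z ∈ tensorGrading V W 1 := (tensor V W).proj_mem 1 x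
    rw [map_par_of_mem V W hz, uzpow_one, Units.smul_def, Units.val_neg,
      Units.val_one, neg_smul, one_smul]
  have h : TensorProduct.map V.par W.par (y + z) = y - z := by
    rw [map_add, h0, h1, sub_eq_add_neg]
  have hyz : y + z = x := (tensor V W).proj_add_proj x
  rw [hyz] at h
  exact h.symm

end

/-- The trivial module `ℂ`, in parity `0`. -/
noncomputable def unit (r : ℕ) [Fact (3 ≤ r)] : WeightModule r where
  carrier := ℂ
  ρ := (Algebra.lmul ℂ ℂ).comp (Ubar.counit r)
  grading i := if i = 0 then ⊤ else ⊥
  isCompl := by simpa using isCompl_top_bot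
  ρ_mem := by
    have key : ∀ a : Ubar r, Ubar.counit r (Ubar.parity r a) = Ubar.counit r a := by
      intro a
      have : (Ubar.counit r).comp (Ubar.parity r) = Ubar.counit r := by
        apply Ubar.algHom_ext <;> simp [Ubar.counit]
      exact DFunLike.congr_fun this a
    intro i j a ha v hv
    have h01 : ∀ p : ZMod 2, p = 0 ∨ p = 1 := by decide
    rcases h01 j with rfl | rfl
    · rcases h01 i with rfl | rfl
      · simp
      · have h := key a
        rw [Ubar.mem_grading_one.1 ha, map_neg] at h
        have h0 : Ubar.counit r a = 0 := by
          have := self_eq_neg.1 h.symm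
          exact this
        simp [h0]
    · have hv0 : v = 0 := by simpa using hv
      simp [hv0]
  iSup_eigenspace := by
    rw [← top_le_iff]
    refine le_iSup_of_le 0 fun x _ => ?_
    rw [Module.End.mem_eigenspace_iff]
    simp [Ubar.counit]
  K_apply := by
    intro μ v hv
    have h : μ * v = 0 := by simpa [Ubar.counit, eq_comm] using hv
    rcases mul_eq_zero.1 h with rfl | rfl
    · simp [Ubar.counit, qpow_zero]
    · simp

end WeightModule

/-! ### The monoidal category of weight modules -/

namespace WeightModule

/-- A morphism of weight modules: a linear map of parity `0` commuting with the action. -/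
@[ext]
structure Hom {r : ℕ} (V W : WeightModule r) where
  toLinearMap : V.carrier →ₗ[ℂ] W.carrier
  map_ρ : ∀ (a : Ubar r) (v : V.carrier), toLinearMap (V.ρ a v) = W.ρ a (toLinearMap v)
  map_grading : ∀ i : ZMod 2, ∀ v ∈ V.grading i, toLinearMap v ∈ W.grading i

variable {r : ℕ}

instance : Category (WeightModule r) where
  Hom := Hom
  id V := ⟨LinearMap.id, fun _ _ => rfl, fun _ _ h => h⟩
  comp f g := ⟨g.toLinearMap ∘ₗ f.toLinearMap,
    fun a v => by rw [LinearMap.comp_apply, f.map_ρ, g.map_ρ, LinearMap.comp_apply],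
    fun i v hv => g.map_grading i _ (f.map_grading i v hv)⟩

@[ext]
lemma hom_ext {V W : WeightModule r} {f g : V ⟶ W} (h : f.toLinearMap = g.toLinearMap) : f = g :=
  Hom.ext h

@[simp] lemma id_toLinearMap (V : WeightModule r) : Hom.toLinearMap (𝟙 V) = LinearMap.id := rfl

@[simp] lemma comp_toLinearMap {U V W : WeightModule r} (f : U ⟶ V) (g : V ⟶ W) :
    (f ≫ g).toLinearMap = g.toLinearMap ∘ₗ f.toLinearMap := rfl

lemma Hom.map_par {V W : WeightModule r} (f : Hom V W) (v : V.carrier) :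
    f.toLinearMap (V.par v) = W.par (f.toLinearMap v) := by
  conv_rhs => rw [← V.proj_add_proj v]
  rw [map_add, map_add, W.par_of_mem_zero (f.map_grading 0 _ (V.proj_mem 0 v)),
    W.par_of_mem_one (f.map_grading 1 _ (V.proj_mem 1 v)), par_apply, map_sub, sub_eq_add_neg]

lemma intertwines_of_gen {V W : WeightModule r} (f : V.carrier →ₗ[ℂ] W.carrier)
    (hH : ∀ v, f (V.ρ Ubar.H v) = W.ρ Ubar.H (f v))
    (hK : ∀ v, f (V.ρ Ubar.K v) = W.ρ Ubar.K (f v))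
    (hKinv : ∀ v, f (V.ρ Ubar.Kinv v) = W.ρ Ubar.Kinv (f v))
    (hE : ∀ v, f (V.ρ Ubar.E v) = W.ρ Ubar.E (f v))
    (hF : ∀ v, f (V.ρ Ubar.F v) = W.ρ Ubar.F (f v)) (a : Ubar r) :
    ∀ v, f (V.ρ a v) = W.ρ a (f v) := by
  induction a using Ubar.induction with
  | halg c =>
    intro v
    rw [AlgHom.commutes, AlgHom.commutes, Module.algebraMap_end_apply,
      Module.algebraMap_end_apply, map_smul]
  | hH => exact hH
  | hK => exact hK
  | hKinv => exact hKinv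
  | hE => exact hE
  | hF => exact hF
  | hadd a b ha hb =>
    intro v
    rw [map_add, map_add, LinearMap.add_apply, LinearMap.add_apply, map_add, ha, hb]
  | hmul a b ha hb =>
    intro v
    rw [map_mul, map_mul, Module.End.mul_apply, Module.End.mul_apply, ha, hb]

/-- An isomorphism of weight modules from a linear equivalence. -/
def isoOfEquiv {V W : WeightModule r} (e : V.carrier ≃ₗ[ℂ] W.carrier)
    (hH : ∀ v, e (V.ρ Ubar.H v) = W.ρ Ubar.H (e v))
    (hK : ∀ v, e (V.ρ Ubar.K v) = W.ρ Ubar.K (e v))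
    (hKinv : ∀ v, e (V.ρ Ubar.Kinv v) = W.ρ Ubar.Kinv (e v))
    (hE : ∀ v, e (V.ρ Ubar.E v) = W.ρ Ubar.E (e v))
    (hF : ∀ v, e (V.ρ Ubar.F v) = W.ρ Ubar.F (e v))
    (hpar : ∀ v, e (V.par v) = W.par (e v)) : V ≅ W where
  hom := ⟨e.toLinearMap, intertwines_of_gen e.toLinearMap hH hK hKinv hE hF, fun i v hv => by
    rw [mem_iff] at hv ⊢
    change W.par (e v) = _
    rw [← hpar, hv, map_zsmul_unit]
    rfl⟩
  inv := ⟨e.symm.toLinearMap, fun a w => by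
      have h := intertwines_of_gen e.toLinearMap hH hK hKinv hE hF a (e.symm w)
      change e _ = W.ρ a (e (e.symm w)) at h
      rw [e.apply_symm_apply] at h
      change e.symm (W.ρ a w) = _
      rw [← h, e.symm_apply_apply]
      rfl, fun i w hw => by
    rw [mem_iff] at hw ⊢
    change V.par (e.symm w) = _
    apply e.injective
    rw [hpar, e.apply_symm_apply, hw, map_zsmul_unit]
    change _ = _ • e (e.symm w)
    rw [e.apply_symm_apply]⟩
  hom_inv_id := by
    apply Hom.ext
    exact LinearMap.ext fun v => e.symm_apply_apply v
  inv_hom_id := by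
    apply Hom.ext
    exact LinearMap.ext fun v => e.apply_symm_apply v

section

variable [Fact (3 ≤ r)]

lemma mem_unit_grading_zero (c : ℂ) : c ∈ (unit r).grading 0 := by
  change c ∈ (if (0 : ZMod 2) = 0 then ⊤ else ⊥ : Submodule ℂ ℂ)
  rw [if_pos rfl]
  exact Submodule.mem_top

lemma unit_par (c : ℂ) : (unit r).par c = c := (unit r).par_of_mem_zero (mem_unit_grading_zero c)

lemma unit_ρ (a : Ubar r) (c : ℂ) : (unit r).ρ a c = Ubar.counit r a * c := rfl

lemma counit_H : Ubar.counit r Ubar.H = 0 := Ubar.lift_H _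
lemma counit_K : Ubar.counit r Ubar.K = 1 := Ubar.lift_K _
lemma counit_Kinv : Ubar.counit r Ubar.Kinv = 1 := Ubar.lift_Kinv _
lemma counit_E : Ubar.counit r Ubar.E = 0 := Ubar.lift_E _
lemma counit_F : Ubar.counit r Ubar.F = 0 := Ubar.lift_F _

end

section

variable [Fact (3 ≤ r)] [Fact (r ≠ 4)]

section

variable (V W : WeightModule r) (v : V.carrier) (w : W.carrier)

lemma tensor_H : (tensor V W).ρ Ubar.H (v ⊗ₜ[ℂ] w : V.carrier ⊗[ℂ] W.carrier) =
    (V.ρ Ubar.H v ⊗ₜ[ℂ] w + v ⊗ₜ[ℂ] W.ρ Ubar.H w : V.carrier ⊗[ℂ] W.carrier) :=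
  LinearMap.congr_fun (tensorρ_H V W) (v ⊗ₜ w)

lemma tensor_K : (tensor V W).ρ Ubar.K (v ⊗ₜ[ℂ] w : V.carrier ⊗[ℂ] W.carrier) =
    (V.ρ Ubar.K v ⊗ₜ[ℂ] W.ρ Ubar.K w : V.carrier ⊗[ℂ] W.carrier) :=
  LinearMap.congr_fun (tensorρ_K V W) (v ⊗ₜ w)

lemma tensor_Kinv : (tensor V W).ρ Ubar.Kinv (v ⊗ₜ[ℂ] w : V.carrier ⊗[ℂ] W.carrier) =
    (V.ρ Ubar.Kinv v ⊗ₜ[ℂ] W.ρ Ubar.Kinv w : V.carrier ⊗[ℂ] W.carrier) :=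
  LinearMap.congr_fun (tensorρ_Kinv V W) (v ⊗ₜ w)

lemma tensor_E : (tensor V W).ρ Ubar.E (v ⊗ₜ[ℂ] w : V.carrier ⊗[ℂ] W.carrier) =
    (V.par v ⊗ₜ[ℂ] W.ρ Ubar.E w + V.ρ Ubar.E v ⊗ₜ[ℂ] W.ρ Ubar.K w :
      V.carrier ⊗[ℂ] W.carrier) :=
  LinearMap.congr_fun (tensorρ_E V W) (v ⊗ₜ w)

lemma tensor_F : (tensor V W).ρ Ubar.F (v ⊗ₜ[ℂ] w : V.carrier ⊗[ℂ] W.carrier) =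
    (V.ρ Ubar.Kinv (V.par v) ⊗ₜ[ℂ] W.ρ Ubar.F w + V.ρ Ubar.F v ⊗ₜ[ℂ] w :
      V.carrier ⊗[ℂ] W.carrier) :=
  LinearMap.congr_fun (tensorρ_F V W) (v ⊗ₜ w)

lemma tensor_par_tmul : (tensor V W).par (v ⊗ₜ[ℂ] w : V.carrier ⊗[ℂ] W.carrier) =
    (V.par v ⊗ₜ[ℂ] W.par w : V.carrier ⊗[ℂ] W.carrier) :=
  LinearMap.congr_fun (tensor_par V W) (v ⊗ₜ w)

end

/-- Two linear maps out of `V ⊗ W` which agree on pure tensors agree. -/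
lemma tensor_induction {V W : WeightModule r} {X : Type*} [AddCommGroup X] [Module ℂ X]
    (f g : (tensor V W).carrier →ₗ[ℂ] X)
    (h : ∀ v w, f (v ⊗ₜ[ℂ] w : V.carrier ⊗[ℂ] W.carrier) =
      g (v ⊗ₜ[ℂ] w : V.carrier ⊗[ℂ] W.carrier)) (x : (tensor V W).carrier) : f x = g x :=
  LinearMap.congr_fun (TensorProduct.ext' (M := V.carrier) (N := W.carrier)
    (g := f) (h := g) h) x

/-- The tensor product of morphisms. -/
noncomputable def tensorMap {V V' W W' : WeightModule r} (f : V ⟶ V') (g : W ⟶ W') :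
    tensor V W ⟶ tensor V' W' where
  toLinearMap := TensorProduct.map f.toLinearMap g.toLinearMap
  map_ρ := by
    have key : ∀ (S : Module.End ℂ (tensor V W).carrier) (S' : Module.End ℂ (tensor V' W').carrier),
        (∀ v w, (TensorProduct.map f.toLinearMap g.toLinearMap :
          V.carrier ⊗[ℂ] W.carrier →ₗ[ℂ] V'.carrier ⊗[ℂ] W'.carrier)
            (S (v ⊗ₜ[ℂ] w : V.carrier ⊗[ℂ] W.carrier)) =
          S' (f.toLinearMap v ⊗ₜ[ℂ] g.toLinearMap w : V'.carrier ⊗[ℂ] W'.carrier)) →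
        ∀ x, (TensorProduct.map f.toLinearMap g.toLinearMap :
          V.carrier ⊗[ℂ] W.carrier →ₗ[ℂ] V'.carrier ⊗[ℂ] W'.carrier) (S x) =
          S' ((TensorProduct.map f.toLinearMap g.toLinearMap :
          V.carrier ⊗[ℂ] W.carrier →ₗ[ℂ] V'.carrier ⊗[ℂ] W'.carrier) x) := by
      intro S S' h x
      exact tensor_induction
        ((TensorProduct.map f.toLinearMap g.toLinearMap :
          V.carrier ⊗[ℂ] W.carrier →ₗ[ℂ] V'.carrier ⊗[ℂ] W'.carrier) ∘ₗ S)
        (S' ∘ₗ (TensorProduct.map f.toLinearMap g.toLinearMap :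
          V.carrier ⊗[ℂ] W.carrier →ₗ[ℂ] V'.carrier ⊗[ℂ] W'.carrier)) h x
    intro a
    refine intertwines_of_gen (V := tensor V W) (W := tensor V' W')
      (TensorProduct.map f.toLinearMap g.toLinearMap) ?_ ?_ ?_ ?_ ?_ a
    · refine key _ _ fun v w => ?_
      rw [tensor_H, tensor_H, map_add, TensorProduct.map_tmul, TensorProduct.map_tmul, f.map_ρ,
        g.map_ρ]
    · refine key _ _ fun v w => ?_
      rw [tensor_K, tensor_K, TensorProduct.map_tmul, f.map_ρ, g.map_ρ]
    · refine key _ _ fun v w => ?_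
      rw [tensor_Kinv, tensor_Kinv, TensorProduct.map_tmul, f.map_ρ, g.map_ρ]
    · refine key _ _ fun v w => ?_
      rw [tensor_E, tensor_E, map_add, TensorProduct.map_tmul, TensorProduct.map_tmul, f.map_ρ,
        g.map_ρ, g.map_ρ, f.map_par]
    · refine key _ _ fun v w => ?_
      rw [tensor_F, tensor_F, map_add, TensorProduct.map_tmul, TensorProduct.map_tmul, f.map_ρ,
        f.map_ρ, g.map_ρ, f.map_par]
  map_grading p x hx := by
    refine tensorGrading_le V W
      (S := (tensorGrading V' W' p).comap (TensorProduct.map f.toLinearMap g.toLinearMap)) ?_ hx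
    intro a b hab v hv w hw
    rw [Submodule.mem_comap, TensorProduct.map_tmul]
    exact mem_tensorGrading V' W' hab (f.map_grading a v hv) (g.map_grading b w hw)

lemma assoc_aux {U V W : WeightModule r} (S : Module.End ℂ (tensor (tensor U V) W).carrier)
    (S' : Module.End ℂ (tensor U (tensor V W)).carrier)
    (h : ∀ u v w, TensorProduct.assoc ℂ U.carrier V.carrier W.carrier
      (S ((u ⊗ₜ[ℂ] v) ⊗ₜ[ℂ] w : (U.carrier ⊗[ℂ] V.carrier) ⊗[ℂ] W.carrier)) =
      S' (u ⊗ₜ[ℂ] (v ⊗ₜ[ℂ] w) : U.carrier ⊗[ℂ] (V.carrier ⊗[ℂ] W.carrier)))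
    (x : (tensor (tensor U V) W).carrier) :
    TensorProduct.assoc ℂ U.carrier V.carrier W.carrier (S x) =
      S' (TensorProduct.assoc ℂ U.carrier V.carrier W.carrier x) :=
  LinearMap.congr_fun (TensorProduct.ext_threefold
    (g := (TensorProduct.assoc ℂ U.carrier V.carrier W.carrier).toLinearMap ∘ₗ S)
    (h := S' ∘ₗ (TensorProduct.assoc ℂ U.carrier V.carrier W.carrier).toLinearMap) h) x

/-- The associativity isomorphism. -/
noncomputable def assocIso (U V W : WeightModule r) :
    tensor (tensor U V) W ≅ tensor U (tensor V W) := by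
  refine isoOfEquiv (V := tensor (tensor U V) W) (W := tensor U (tensor V W))
    (TensorProduct.assoc ℂ U.carrier V.carrier W.carrier) ?_ ?_ ?_ ?_ ?_ ?_
  · refine assoc_aux _ _ fun u v w => ?_
    have h1 := tensor_H (tensor U V) W (u ⊗ₜ[ℂ] v : U.carrier ⊗[ℂ] V.carrier) w
    have h2 := tensor_H U (tensor V W) u (v ⊗ₜ[ℂ] w : V.carrier ⊗[ℂ] W.carrier)
    rw [tensor_H] at h1 h2
    refine (congrArg _ h1).trans (Eq.trans ?_ h2.symm)
    change TensorProduct.assoc ℂ U.carrier V.carrier W.carrier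
      ((U.ρ Ubar.H u ⊗ₜ[ℂ] v + u ⊗ₜ[ℂ] V.ρ Ubar.H v) ⊗ₜ[ℂ] w + (u ⊗ₜ[ℂ] v) ⊗ₜ[ℂ] W.ρ Ubar.H w) =
      U.ρ Ubar.H u ⊗ₜ[ℂ] (v ⊗ₜ[ℂ] w) + u ⊗ₜ[ℂ] (V.ρ Ubar.H v ⊗ₜ[ℂ] w + v ⊗ₜ[ℂ] W.ρ Ubar.H w)
    simp only [TensorProduct.add_tmul, TensorProduct.tmul_add, map_add, TensorProduct.assoc_tmul]
    abel
  · refine assoc_aux _ _ fun u v w => ?_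
    have h1 := tensor_K (tensor U V) W (u ⊗ₜ[ℂ] v : U.carrier ⊗[ℂ] V.carrier) w
    have h2 := tensor_K U (tensor V W) u (v ⊗ₜ[ℂ] w : V.carrier ⊗[ℂ] W.carrier)
    rw [tensor_K] at h1 h2
    exact (congrArg _ h1).trans h2.symm
  · refine assoc_aux _ _ fun u v w => ?_
    have h1 := tensor_Kinv (tensor U V) W (u ⊗ₜ[ℂ] v : U.carrier ⊗[ℂ] V.carrier) w
    have h2 := tensor_Kinv U (tensor V W) u (v ⊗ₜ[ℂ] w : V.carrier ⊗[ℂ] W.carrier)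
    rw [tensor_Kinv] at h1 h2
    exact (congrArg _ h1).trans h2.symm
  · refine assoc_aux _ _ fun u v w => ?_
    have h1 := tensor_E (tensor U V) W (u ⊗ₜ[ℂ] v : U.carrier ⊗[ℂ] V.carrier) w
    have h2 := tensor_E U (tensor V W) u (v ⊗ₜ[ℂ] w : V.carrier ⊗[ℂ] W.carrier)
    rw [tensor_E, tensor_par_tmul] at h1
    rw [tensor_E, tensor_K] at h2
    refine (congrArg _ h1).trans (Eq.trans ?_ h2.symm)
    change TensorProduct.assoc ℂ U.carrier V.carrier W.carrier
      ((U.par u ⊗ₜ[ℂ] V.par v) ⊗ₜ[ℂ] W.ρ Ubar.E w +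
        (U.par u ⊗ₜ[ℂ] V.ρ Ubar.E v + U.ρ Ubar.E u ⊗ₜ[ℂ] V.ρ Ubar.K v) ⊗ₜ[ℂ] W.ρ Ubar.K w) =
      U.par u ⊗ₜ[ℂ] (V.par v ⊗ₜ[ℂ] W.ρ Ubar.E w + V.ρ Ubar.E v ⊗ₜ[ℂ] W.ρ Ubar.K w) +
        U.ρ Ubar.E u ⊗ₜ[ℂ] (V.ρ Ubar.K v ⊗ₜ[ℂ] W.ρ Ubar.K w)
    simp only [TensorProduct.add_tmul, TensorProduct.tmul_add, map_add, TensorProduct.assoc_tmul]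
    abel
  · refine assoc_aux _ _ fun u v w => ?_
    have h1 := tensor_F (tensor U V) W (u ⊗ₜ[ℂ] v : U.carrier ⊗[ℂ] V.carrier) w
    have h2 := tensor_F U (tensor V W) u (v ⊗ₜ[ℂ] w : V.carrier ⊗[ℂ] W.carrier)
    rw [tensor_F, tensor_par_tmul, tensor_Kinv] at h1
    rw [tensor_F] at h2
    refine (congrArg _ h1).trans (Eq.trans ?_ h2.symm)
    change TensorProduct.assoc ℂ U.carrier V.carrier W.carrier
      ((U.ρ Ubar.Kinv (U.par u) ⊗ₜ[ℂ] V.ρ Ubar.Kinv (V.par v)) ⊗ₜ[ℂ] W.ρ Ubar.F w +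
        (U.ρ Ubar.Kinv (U.par u) ⊗ₜ[ℂ] V.ρ Ubar.F v + U.ρ Ubar.F u ⊗ₜ[ℂ] v) ⊗ₜ[ℂ] w) =
      U.ρ Ubar.Kinv (U.par u) ⊗ₜ[ℂ]
          (V.ρ Ubar.Kinv (V.par v) ⊗ₜ[ℂ] W.ρ Ubar.F w + V.ρ Ubar.F v ⊗ₜ[ℂ] w) +
        U.ρ Ubar.F u ⊗ₜ[ℂ] (v ⊗ₜ[ℂ] w)
    simp only [TensorProduct.add_tmul, TensorProduct.tmul_add, map_add, TensorProduct.assoc_tmul]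
    abel
  · refine assoc_aux _ _ fun u v w => ?_
    have h1 := tensor_par_tmul (tensor U V) W (u ⊗ₜ[ℂ] v : U.carrier ⊗[ℂ] V.carrier) w
    have h2 := tensor_par_tmul U (tensor V W) u (v ⊗ₜ[ℂ] w : V.carrier ⊗[ℂ] W.carrier)
    rw [tensor_par_tmul] at h1 h2
    exact (congrArg _ h1).trans h2.symm

lemma lid_aux {V : WeightModule r} (S : Module.End ℂ (tensor (unit r) V).carrier)
    (S' : Module.End ℂ V.carrier)
    (h : ∀ v, TensorProduct.lid ℂ V.carrier (S ((1 : ℂ) ⊗ₜ[ℂ] v : ℂ ⊗[ℂ] V.carrier)) = S' v)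
    (x : (tensor (unit r) V).carrier) :
    TensorProduct.lid ℂ V.carrier (S x) = S' (TensorProduct.lid ℂ V.carrier x) := by
  obtain ⟨v, rfl⟩ : ∃ v, ((1 : ℂ) ⊗ₜ[ℂ] v : ℂ ⊗[ℂ] V.carrier) = x :=
    ⟨TensorProduct.lid ℂ V.carrier x, (TensorProduct.lid ℂ V.carrier).symm_apply_apply x⟩
  rw [h, TensorProduct.lid_tmul, one_smul]

/-- The left unit isomorphism. -/
noncomputable def leftUnitorIso (V : WeightModule r) : tensor (unit r) V ≅ V := by
  refine isoOfEquiv (V := tensor (unit r) V) (W := V) (TensorProduct.lid ℂ V.carrier)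
    ?_ ?_ ?_ ?_ ?_ ?_
  · refine lid_aux _ _ fun v => ?_
    refine (congrArg _ (tensor_H (unit r) V (1 : ℂ) v)).trans ?_
    change TensorProduct.lid ℂ V.carrier
      ((Ubar.counit r Ubar.H * 1 : ℂ) ⊗ₜ[ℂ] v + (1 : ℂ) ⊗ₜ[ℂ] V.ρ Ubar.H v) = _
    simp [counit_H]
  · refine lid_aux _ _ fun v => ?_
    refine (congrArg _ (tensor_K (unit r) V (1 : ℂ) v)).trans ?_
    change TensorProduct.lid ℂ V.carrier ((Ubar.counit r Ubar.K * 1 : ℂ) ⊗ₜ[ℂ] V.ρ Ubar.K v) = _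
    simp [counit_K]
  · refine lid_aux _ _ fun v => ?_
    refine (congrArg _ (tensor_Kinv (unit r) V (1 : ℂ) v)).trans ?_
    change TensorProduct.lid ℂ V.carrier
      ((Ubar.counit r Ubar.Kinv * 1 : ℂ) ⊗ₜ[ℂ] V.ρ Ubar.Kinv v) = _
    simp [counit_Kinv]
  · refine lid_aux _ _ fun v => ?_
    refine (congrArg _ (tensor_E (unit r) V (1 : ℂ) v)).trans ?_
    rw [show (unit r).par (1 : ℂ) = (1 : ℂ) from unit_par (1 : ℂ)]
    change TensorProduct.lid ℂ V.carrier
      ((1 : ℂ) ⊗ₜ[ℂ] V.ρ Ubar.E v + (Ubar.counit r Ubar.E * 1 : ℂ) ⊗ₜ[ℂ] V.ρ Ubar.K v) = _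
    simp [counit_E]
  · refine lid_aux _ _ fun v => ?_
    refine (congrArg _ (tensor_F (unit r) V (1 : ℂ) v)).trans ?_
    rw [show (unit r).par (1 : ℂ) = (1 : ℂ) from unit_par (1 : ℂ)]
    change TensorProduct.lid ℂ V.carrier
      ((Ubar.counit r Ubar.Kinv * 1 : ℂ) ⊗ₜ[ℂ] V.ρ Ubar.F v +
        (Ubar.counit r Ubar.F * 1 : ℂ) ⊗ₜ[ℂ] v) = _
    simp [counit_F, counit_Kinv]
  · refine lid_aux _ _ fun v => ?_
    refine (congrArg _ (tensor_par_tmul (unit r) V (1 : ℂ) v)).trans ?_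
    rw [show (unit r).par (1 : ℂ) = (1 : ℂ) from unit_par (1 : ℂ)]
    change TensorProduct.lid ℂ V.carrier ((1 : ℂ) ⊗ₜ[ℂ] V.par v) = _
    simp

lemma rid_aux {V : WeightModule r} (S : Module.End ℂ (tensor V (unit r)).carrier)
    (S' : Module.End ℂ V.carrier)
    (h : ∀ v, TensorProduct.rid ℂ V.carrier (S (v ⊗ₜ[ℂ] (1 : ℂ) : V.carrier ⊗[ℂ] ℂ)) = S' v)
    (x : (tensor V (unit r)).carrier) :
    TensorProduct.rid ℂ V.carrier (S x) = S' (TensorProduct.rid ℂ V.carrier x) := by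
  obtain ⟨v, rfl⟩ : ∃ v, (v ⊗ₜ[ℂ] (1 : ℂ) : V.carrier ⊗[ℂ] ℂ) = x :=
    ⟨TensorProduct.rid ℂ V.carrier x, (TensorProduct.rid ℂ V.carrier).symm_apply_apply x⟩
  rw [h, TensorProduct.rid_tmul, one_smul]

/-- The right unit isomorphism. -/
noncomputable def rightUnitorIso (V : WeightModule r) : tensor V (unit r) ≅ V := by
  refine isoOfEquiv (V := tensor V (unit r)) (W := V) (TensorProduct.rid ℂ V.carrier)
    ?_ ?_ ?_ ?_ ?_ ?_
  · refine rid_aux _ _ fun v => ?_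
    refine (congrArg _ (tensor_H V (unit r) v (1 : ℂ))).trans ?_
    change TensorProduct.rid ℂ V.carrier
      (V.ρ Ubar.H v ⊗ₜ[ℂ] (1 : ℂ) + v ⊗ₜ[ℂ] (Ubar.counit r Ubar.H * 1 : ℂ)) = _
    simp [counit_H]
  · refine rid_aux _ _ fun v => ?_
    refine (congrArg _ (tensor_K V (unit r) v (1 : ℂ))).trans ?_
    change TensorProduct.rid ℂ V.carrier (V.ρ Ubar.K v ⊗ₜ[ℂ] (Ubar.counit r Ubar.K * 1 : ℂ)) = _
    simp [counit_K]
  · refine rid_aux _ _ fun v => ?_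
    refine (congrArg _ (tensor_Kinv V (unit r) v (1 : ℂ))).trans ?_
    change TensorProduct.rid ℂ V.carrier
      (V.ρ Ubar.Kinv v ⊗ₜ[ℂ] (Ubar.counit r Ubar.Kinv * 1 : ℂ)) = _
    simp [counit_Kinv]
  · refine rid_aux _ _ fun v => ?_
    refine (congrArg _ (tensor_E V (unit r) v (1 : ℂ))).trans ?_
    change TensorProduct.rid ℂ V.carrier
      (V.par v ⊗ₜ[ℂ] (Ubar.counit r Ubar.E * 1 : ℂ) +
        V.ρ Ubar.E v ⊗ₜ[ℂ] (Ubar.counit r Ubar.K * 1 : ℂ)) = _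
    simp [counit_E, counit_K]
  · refine rid_aux _ _ fun v => ?_
    refine (congrArg _ (tensor_F V (unit r) v (1 : ℂ))).trans ?_
    change TensorProduct.rid ℂ V.carrier
      (V.ρ Ubar.Kinv (V.par v) ⊗ₜ[ℂ] (Ubar.counit r Ubar.F * 1 : ℂ) +
        V.ρ Ubar.F v ⊗ₜ[ℂ] (1 : ℂ)) = _
    simp [counit_F]
  · refine rid_aux _ _ fun v => ?_
    refine (congrArg _ (tensor_par_tmul V (unit r) v (1 : ℂ))).trans ?_
    rw [show (unit r).par (1 : ℂ) = (1 : ℂ) from unit_par (1 : ℂ)]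
    change TensorProduct.rid ℂ V.carrier (V.par v ⊗ₜ[ℂ] (1 : ℂ)) = _
    simp

noncomputable instance : MonoidalCategoryStruct (WeightModule r) where
  tensorObj V W := tensor V W
  tensorUnit := unit r
  tensorHom f g := tensorMap f g
  whiskerLeft V _ _ f := tensorMap (𝟙 V) f
  whiskerRight f W := tensorMap f (𝟙 W)
  associator U V W := assocIso U V W
  leftUnitor V := leftUnitorIso V
  rightUnitor V := rightUnitorIso V

noncomputable instance : MonoidalCategory (WeightModule r) :=
  MonoidalCategory.ofTensorHom
    (id_tensorHom_id := fun V W => Hom.ext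
      (TensorProduct.ext' (M := V.carrier) (N := W.carrier) fun _ _ => rfl))
    (id_tensorHom := fun _ _ _ _ => rfl)
    (tensorHom_id := fun _ _ => rfl)
    (tensorHom_comp_tensorHom := fun {X₁ _ _ X₂ _ _} _ _ _ _ => Hom.ext
      (TensorProduct.ext' (M := X₁.carrier) (N := X₂.carrier) fun _ _ => rfl))
    (associator_naturality := fun {X₁ X₂ X₃ _ _ _} _ _ _ => Hom.ext
      (TensorProduct.ext_threefold (M := X₁.carrier) (N := X₂.carrier) (P := X₃.carrier)
        fun _ _ _ => rfl))
    (leftUnitor_naturality := fun {X _} f => Hom.ext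
      (TensorProduct.ext' (M := ℂ) (N := X.carrier) fun c x =>
        (f.toLinearMap.map_smul c x).symm))
    (rightUnitor_naturality := fun {X _} f => Hom.ext
      (TensorProduct.ext' (M := X.carrier) (N := ℂ) fun x c =>
        (f.toLinearMap.map_smul c x).symm))
    (pentagon := fun W X Y Z => Hom.ext
      (TensorProduct.ext_fourfold (M := W.carrier) (N := X.carrier) (P := Y.carrier)
        (Q := Z.carrier) fun _ _ _ _ => rfl))
    (triangle := fun X Y => Hom.ext
      (TensorProduct.ext_threefold (M := X.carrier) (N := ℂ) (P := Y.carrier)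
        fun x c y => (TensorProduct.smul_tmul (R := ℂ) c x y).symm))

end

/-! ### The braiding maps -/

/-- The space of vectors of weight `μ`. -/
noncomputable def weightSpace (V : WeightModule r) (μ : ℂ) : Submodule ℂ V.carrier :=
  (V.ρ Ubar.H).eigenspace μ

lemma weightSpace_isCompl (V : WeightModule r) (μ : ℂ) :
    IsCompl (V.weightSpace μ) (⨆ ν, ⨆ _ : ν ≠ μ, V.weightSpace ν) := by
  refine ⟨(V.ρ Ubar.H).eigenspaces_iSupIndep μ, codisjoint_iff.2 ?_⟩
  rw [← top_le_iff, ← V.iSup_eigenspace]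
  refine iSup_le fun ν => ?_
  by_cases h : ν = μ
  · subst h; exact le_sup_left
  · exact le_sup_of_le_right (le_iSup₂_of_le ν h le_rfl)

/-- The projection onto the space of vectors of weight `μ`, along the other weight spaces. -/
noncomputable def weightProj (V : WeightModule r) (μ : ℂ) : Module.End ℂ V.carrier :=
  (V.weightSpace μ).projection _ (V.weightSpace_isCompl μ)

/-- The finite set of weights of `V`. -/
noncomputable def weights (V : WeightModule r) : Finset ℂ :=
  ((V.ρ Ubar.H).finite_hasEigenvalue).toFinset

/-- The diagonal operator `v ⊗ w ↦ q ^ (μ ν / 2) v ⊗ w` for `v` of weight `μ` and `w` of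
weight `ν`. -/
noncomputable def upsilon (V W : WeightModule r) : Module.End ℂ (V.carrier ⊗[ℂ] W.carrier) :=
  ∑ μ ∈ V.weights, ∑ ν ∈ W.weights,
    qpow r (μ * ν / 2) • TensorProduct.map (V.weightProj μ) (W.weightProj ν)

lemma weightProj_of_mem (V : WeightModule r) {μ : ℂ} {v : V.carrier}
    (hv : v ∈ V.weightSpace μ) : V.weightProj μ v = v :=
  Submodule.projection_apply_of_mem_left _ hv

lemma weightProj_of_mem_ne (V : WeightModule r) {μ ν : ℂ} (h : ν ≠ μ) {v : V.carrier}
    (hv : v ∈ V.weightSpace ν) : V.weightProj μ v = 0 :=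
  (Submodule.projection_apply_eq_zero_iff (V.weightSpace_isCompl μ)).2
    ((le_iSup₂_of_le ν h le_rfl : V.weightSpace ν ≤ ⨆ ν, ⨆ _ : ν ≠ μ, V.weightSpace ν) hv)

lemma mem_weights_of_ne_zero (V : WeightModule r) {μ : ℂ} {v : V.carrier}
    (hv : v ∈ V.weightSpace μ) (h0 : v ≠ 0) : μ ∈ V.weights := by
  rw [weights, Set.Finite.mem_toFinset]
  exact Module.End.hasEigenvalue_of_hasEigenvector ⟨hv, h0⟩

/-- `Υ (v ⊗ w) = q ^ (μ ν / 2) v ⊗ w` for `v` of weight `μ` and `w` of weight `ν`. -/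
lemma upsilon_tmul (V W : WeightModule r) {μ ν : ℂ} {v : V.carrier} {w : W.carrier}
    (hv : V.ρ Ubar.H v = μ • v) (hw : W.ρ Ubar.H w = ν • w) :
    upsilon V W (v ⊗ₜ w) = qpow r (μ * ν / 2) • (v ⊗ₜ[ℂ] w) := by
  have hv' : v ∈ V.weightSpace μ := Module.End.mem_eigenspace_iff.2 hv
  have hw' : w ∈ W.weightSpace ν := Module.End.mem_eigenspace_iff.2 hw
  by_cases hv0 : v = 0
  · subst hv0; simp
  by_cases hw0 : w = 0
  · subst hw0; simp
  simp only [upsilon, LinearMap.sum_apply, LinearMap.smul_apply, TensorProduct.map_tmul]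
  rw [Finset.sum_eq_single μ, Finset.sum_eq_single ν, V.weightProj_of_mem hv',
    W.weightProj_of_mem hw']
  · intro b _ hb
    rw [W.weightProj_of_mem_ne hb.symm hw', TensorProduct.tmul_zero, smul_zero]
  · exact fun h => absurd (W.mem_weights_of_ne_zero hw' hw0) h
  · intro b _ hb
    refine Finset.sum_eq_zero fun c _ => ?_
    rw [V.weightProj_of_mem_ne hb.symm hv', TensorProduct.zero_tmul, smul_zero]
  · exact fun h => absurd (V.mem_weights_of_ne_zero hv' hv0) h

/-- The Koszul symmetry `v ⊗ w ↦ (-1)^(|v| |w|) w ⊗ v`. -/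
noncomputable def koszulSwap (V W : WeightModule r) :
    V.carrier ⊗[ℂ] W.carrier →ₗ[ℂ] W.carrier ⊗[ℂ] V.carrier :=
  ∑ i : ZMod 2, ∑ j : ZMod 2, ((-1 : ℤˣ) ^ (i * j)) •
    ((TensorProduct.comm ℂ V.carrier W.carrier).toLinearMap ∘ₗ
      TensorProduct.map (V.proj i) (W.proj j))

lemma koszulSwap_tmul (V W : WeightModule r) {i j : ZMod 2} {v : V.carrier} {w : W.carrier}
    (hv : v ∈ V.grading i) (hw : w ∈ W.grading j) :
    koszulSwap V W (v ⊗ₜ w) = ((-1 : ℤˣ) ^ (i * j)) • (w ⊗ₜ[ℂ] v) := by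
  have happ : koszulSwap V W (v ⊗ₜ w) = ∑ a : ZMod 2, ∑ b : ZMod 2, ((-1 : ℤˣ) ^ (a * b)) •
      (W.proj b w ⊗ₜ[ℂ] V.proj a v) := by
    rw [koszulSwap, LinearMap.sum_apply]
    refine Finset.sum_congr rfl fun a _ => ?_
    rw [LinearMap.sum_apply]
    rfl
  rw [happ, Finset.sum_eq_single i, Finset.sum_eq_single j, V.proj_of_mem hv, W.proj_of_mem hw]
  · intro b _ hb
    rw [W.proj_of_mem_ne hb.symm hw, TensorProduct.zero_tmul, smul_zero]
  · simp
  · intro b _ hb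
    refine Finset.sum_eq_zero fun c _ => ?_
    rw [V.proj_of_mem_ne hb.symm hv, TensorProduct.tmul_zero, smul_zero]
  · simp

/-- The truncated `R`-matrix
`∑_{l < rbar} (-1)^l q^(l(l-1)/2) (q - q⁻¹)^l / [l]! E^l ⊗ F^l`, an element of the tensor square
of the superalgebra. -/
noncomputable def rMatrix (r : ℕ) : Ubar.Sq r :=
  ∑ l ∈ Finset.range (rbar r),
    ((-1) ^ l * (qpow r (l * (l - 1) / 2) * (q r - (q r)⁻¹) ^ l / sqFact r l)) •
      Ubar.tm (Ubar.E ^ l) (Ubar.F ^ l)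

/-- The map `c_{V,W} = τ ∘ Υ ∘ R̃`. -/
noncomputable def braidingMap (V W : WeightModule r) :
    V.carrier ⊗[ℂ] W.carrier →ₗ[ℂ] W.carrier ⊗[ℂ] V.carrier :=
  koszulSwap V W ∘ₗ upsilon V W ∘ₗ act V W (rMatrix r)

end WeightModule

end OspUnrolled

/-!
The truncated `R`-matrix is a truncated quantum exponential. Write `θ` for the operator of
`E ⊗ F` on `V ⊗ W` and `e_z(x) = ∑_{l < rbar} xˡ / ((1)_z ⋯ (l)_z)` with
`(k)_z = 1 + z + ⋯ + z ^ (k - 1)`. The power `q ^ (l (l - 1) / 2)`, together with the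
Koszul sign by which `(E ⊗ F)ˡ` and `Eˡ ⊗ Fˡ` differ, turns `[l]!` into the factorial
`(1)_z ⋯ (l)_z` at `z = -q⁻²`, so the element `R̃` acts as `e_z (-(q - q⁻¹) θ)`
(`act_rMatrix`), and `c_{V,W} = (τ ∘ Υ) ∘ e_z (-(q - q⁻¹) θ)`. Two identities for quantum
exponentials in an arbitrary algebra then carry the proof.

* `qexp_intertwine`: if `(q - q⁻¹) [b, θ] = a' - a` while `a θ = z θ a` and `θ a' = z a' θ`, then
  `e_z (-(q - q⁻¹) θ) (b + a) = (b + a') e_z (-(q - q⁻¹) θ)`. The commutator with each power of `θ`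
  telescopes, and the term lost to the truncation vanishes because `E ^ rbar = F ^ rbar = 0`. With
  `b = 1 ⊗ E`, `a = E ⊗ K`, `a' = E ⊗ K⁻¹` and with `b = F ⊗ 1`, `a = K⁻¹ ⊗ F`, `a' = K ⊗ F`, this
  moves `R̃` past `Δ(E)` and `Δ(F)`; the operator `τ ∘ Υ` turns the result into the coproduct on
  `W ⊗ V`.
* `qexp_add`: if `y x = z x y`, then `e_z (x + y) = e_z x e_z y`. It applies to
  `(id ⊗ Δ)(E ⊗ F) = E ⊗ K⁻¹ ⊗ F + E ⊗ F ⊗ 1` and `(Δ ⊗ id)(E ⊗ F) = E ⊗ K ⊗ F + 1 ⊗ E ⊗ F`. The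
  factors `K⁻¹` and `K` in the first summands are those produced by moving `E ⊗ F` past `τ ∘ Υ` on
  the other pair of tensor factors (`theta_comp_twist_fwd`, `theta_comp_twist_rev`), so the hexagons
  reduce to the multiplicativity of `τ ∘ Υ`, that is, to the bilinearity of `(λ, μ) ↦ λ μ / 2` and
  of the exponent of the Koszul sign.

Invertibility holds because `θ` is nilpotent and `τ ∘ Υ` permutes homogeneous weight vectors up to
nonzero scalars. Identities of diagonal operators are checked on such vectors
(`linearMap_ext_homog`).
-/

namespace OspUnrolled

/-! ### Truncated quantum exponentials -/

section QExp

/-- The coefficient `t ^ l / ((1)_z ⋯ (l)_z)` of the quantum exponential, where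
`(k)_z = 1 + z + ⋯ + z ^ (k - 1)`. -/
noncomputable def qexpCoeff (z t : ℂ) (l : ℕ) : ℂ :=
  ∏ k ∈ Finset.range l, (t / ∑ i ∈ Finset.range (k + 1), z ^ i)

lemma qexpCoeff_zero (z t : ℂ) : qexpCoeff z t 0 = 1 := rfl

lemma qexpCoeff_succ_mul {z : ℂ} (t : ℂ) {l : ℕ}
    (h : ∑ i ∈ Finset.range (l + 1), z ^ i ≠ 0) :
    qexpCoeff z t (l + 1) * ∑ i ∈ Finset.range (l + 1), z ^ i = t * qexpCoeff z t l := by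
  rw [qexpCoeff, Finset.prod_range_succ, mul_assoc, div_mul_cancel₀ _ h, mul_comm]
  rfl

/-- The Gaussian binomial coefficient is the ratio of the coefficients of the quantum
exponential. -/
lemma qexpCoeff_mul_gaussCoeff {z : ℂ} (t : ℂ) {N i j : ℕ}
    (hz : ∀ k, k + 1 < N → ∑ i ∈ Finset.range (k + 1), z ^ i ≠ 0) (hij : i + j < N) :
    qexpCoeff z t (i + j) * gaussCoeff z i j = qexpCoeff z t i * qexpCoeff z t j := by
  have hne : ∀ m < N, ∏ k ∈ Finset.range m, ∑ l ∈ Finset.range (k + 1), z ^ l ≠ 0 := fun m hm =>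
    Finset.prod_ne_zero_iff.2 fun k hk => hz k (by rw [Finset.mem_range] at hk; omega)
  have h := gaussCoeff_mul z i j
  have hi := hne i (by omega)
  have hj := hne j (by omega)
  have hn := hne (i + j) hij
  simp only [qexpCoeff, Finset.prod_div_distrib, Finset.prod_const, Finset.card_range]
  field_simp
  rw [pow_add, ← h]
  ring

variable {A B : Type*} [Ring A] [Algebra ℂ A] [Ring B] [Algebra ℂ B]

/-- The quantum exponential of `t x` in the parameter `z`, truncated to its first `N` terms. -/
noncomputable def qexp (z t : ℂ) (N : ℕ) (x : A) : A :=
  ∑ l ∈ Finset.range N, qexpCoeff z t l • x ^ l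

lemma map_qexp (φ : A →ₐ[ℂ] B) (z t : ℂ) (N : ℕ) (x : A) :
    φ (qexp z t N x) = qexp z t N (φ x) := by
  simp [qexp, map_sum]

/-- If `y x = z x y`, the quantum exponential turns the sum `x + y` into the product. -/
lemma qexp_add {z : ℂ} (t : ℂ) {N : ℕ}
    (hz : ∀ k, k + 1 < N → ∑ i ∈ Finset.range (k + 1), z ^ i ≠ 0) {x y : A}
    (hyx : y * x = z • (x * y)) (h0 : ∀ i j, N ≤ i + j → x ^ i * y ^ j = 0) :
    qexp z t N (x + y) = qexp z t N x * qexp z t N y := by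
  let f : ℕ × ℕ → A := fun p => (qexpCoeff z t p.1 * qexpCoeff z t p.2) • (x ^ p.1 * y ^ p.2)
  let S := (Finset.range N ×ˢ Finset.range N).filter fun p : ℕ × ℕ => p.1 + p.2 < N
  have hL : qexp z t N (x + y) = ∑ n ∈ Finset.range N, ∑ p ∈ S with p.1 + p.2 = n, f p := by
    refine Finset.sum_congr rfl fun n hn => ?_
    rw [Finset.mem_range] at hn
    have hS : (S.filter fun p => p.1 + p.2 = n) = Finset.HasAntidiagonal.antidiagonal n := by
      ext ⟨i, j⟩
      simp only [S, Finset.mem_filter, Finset.mem_product, Finset.mem_range,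
        Finset.HasAntidiagonal.mem_antidiagonal]
      omega
    rw [hS, add_pow_skew z x y hyx, Finset.smul_sum]
    refine Finset.sum_congr rfl fun p hp => ?_
    rw [Finset.HasAntidiagonal.mem_antidiagonal] at hp
    subst hp
    rw [smul_smul, qexpCoeff_mul_gaussCoeff t hz hn]
  -- The terms of the product with `i + j ≥ N` vanish, so only those of the truncated sum remain.
  rw [hL, Finset.sum_fiberwise_of_maps_to
      (fun p hp => Finset.mem_range.2 (Finset.mem_filter.1 hp).2),
    Finset.sum_filter_of_ne, Finset.sum_product, qexp, qexp, Finset.sum_mul_sum]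
  · refine Finset.sum_congr rfl fun i _ => Finset.sum_congr rfl fun j _ => ?_
    rw [smul_mul_smul_comm]
  · intro p _ hp
    by_contra hlt
    exact hp (by simp only [f]; rw [h0 _ _ (not_lt.1 hlt), smul_zero])

/-- If `s [b, x] = a' - a`, the commutator of `b` with a power of `x` telescopes: moving all the
`a'` to the left and all the `a` to the right produces the same factor `(l + 1)_z`. -/
lemma smul_commutator_pow {z s : ℂ} {x a a' b : A} (hb : s • (b * x - x * b) = a' - a)
    (ha : a * x = z • (x * a)) (ha' : x * a' = z • (a' * x)) (l : ℕ) :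
    s • (b * x ^ (l + 1) - x ^ (l + 1) * b) =
      (∑ i ∈ Finset.range (l + 1), z ^ i) • (a' * x ^ l - x ^ l * a) := by
  have hpow : ∀ l, x ^ l * a' = z ^ l • (a' * x ^ l) := by
    intro l
    induction l with
    | zero => simp
    | succ l ih =>
      rw [pow_succ', mul_assoc, ih, mul_smul_comm, ← mul_assoc, ha', smul_mul_assoc, smul_smul,
        mul_assoc, ← pow_succ, ← pow_succ']
  induction l with
  | zero => simpa using hb
  | succ l ih =>
    have h1 : b * x ^ (l + 1 + 1) - x ^ (l + 1 + 1) * b =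
        (b * x ^ (l + 1) - x ^ (l + 1) * b) * x + x ^ (l + 1) * (b * x - x * b) := by
      rw [pow_succ x (l + 1)]; noncomm_ring
    rw [h1, smul_add, ← smul_mul_assoc, ← mul_smul_comm, ih, hb, mul_sub, hpow,
      Finset.sum_range_succ _ (l + 1), add_smul, smul_mul_assoc, sub_mul, mul_assoc, ← pow_succ,
      mul_assoc, ha, mul_smul_comm, ← mul_assoc, ← pow_succ]
    have h2 : (∑ i ∈ Finset.range (l + 1), z ^ i) * z + 1 =
        ∑ i ∈ Finset.range (l + 1), z ^ i + z ^ (l + 1) := by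
      rw [← Finset.sum_range_succ, Finset.sum_range_succ' _ (l + 1), Finset.sum_mul]
      simp [pow_succ]
    have h3 : z ^ (l + 1) = (∑ i ∈ Finset.range (l + 1), z ^ i) * z + 1 -
        ∑ i ∈ Finset.range (l + 1), z ^ i := by rw [h2]; ring
    rw [h3]
    module

/-- The quantum exponential intertwines `b + a` and `b + a'` when `[b, x]` is proportional to
`a' - a` and `a`, `a'` skew-commute with `x`. -/
lemma qexp_intertwine {z s : ℂ} {N : ℕ} (hN : 0 < N) (hs : s ≠ 0)
    (hz : ∀ k, k + 1 < N → ∑ i ∈ Finset.range (k + 1), z ^ i ≠ 0) {x a a' b : A}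
    (hb : s • (b * x - x * b) = a' - a)
    (ha : a * x = z • (x * a)) (ha' : x * a' = z • (a' * x))
    (ha0 : x ^ (N - 1) * a = 0) (ha'0 : a' * x ^ (N - 1) = 0) :
    qexp z (-s) N x * (b + a) = (b + a') * qexp z (-s) N x := by
  obtain ⟨n, rfl⟩ : ∃ n, N = n + 1 := ⟨N - 1, by omega⟩
  rw [Nat.add_sub_cancel] at ha0 ha'0
  have hcomm : b * qexp z (-s) (n + 1) x - qexp z (-s) (n + 1) x * b =
      -(∑ l ∈ Finset.range n, qexpCoeff z (-s) l • (a' * x ^ l - x ^ l * a)) := by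
    rw [qexp, Finset.mul_sum, Finset.sum_mul, ← Finset.sum_sub_distrib, Finset.sum_range_succ']
    simp only [mul_smul_comm, smul_mul_assoc, ← smul_sub, pow_zero, mul_one, one_mul, sub_self,
      add_zero]
    rw [← Finset.sum_neg_distrib]
    refine Finset.sum_congr rfl fun l hl => ?_
    rw [Finset.mem_range] at hl
    have h1 := smul_commutator_pow hb ha ha' l
    have h2 := qexpCoeff_succ_mul (-s) (hz l (by omega))
    have h3 : b * x ^ (l + 1) - x ^ (l + 1) * b =
        s⁻¹ • ((∑ i ∈ Finset.range (l + 1), z ^ i) • (a' * x ^ l - x ^ l * a)) := by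
      rw [← h1, smul_smul, inv_mul_cancel₀ hs, one_smul]
    have h4 : qexpCoeff z (-s) (l + 1) * (s⁻¹ * ∑ i ∈ Finset.range (l + 1), z ^ i) =
        -qexpCoeff z (-s) l := by
      rw [mul_left_comm, h2]
      field_simp
    rw [h3, smul_smul, smul_smul, mul_assoc, h4, neg_smul]
  -- The sum stops at `l = n - 1`; the missing term `l = n` vanishes by `ha0` and `ha'0`.
  have hL : ∑ l ∈ Finset.range n, qexpCoeff z (-s) l • (a' * x ^ l - x ^ l * a) =
      a' * qexp z (-s) (n + 1) x - qexp z (-s) (n + 1) x * a := by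
    rw [qexp, Finset.mul_sum, Finset.sum_mul, ← Finset.sum_sub_distrib, Finset.sum_range_succ]
    simp only [mul_smul_comm, smul_mul_assoc, ← smul_sub, ha0, ha'0, sub_self, smul_zero, add_zero]
  rw [hL] at hcomm
  rw [mul_add, add_mul, ← sub_eq_zero, ← neg_eq_zero]
  rw [eq_neg_iff_add_eq_zero] at hcomm
  rw [← hcomm]
  abel

lemma isUnit_qexp (z t : ℂ) {N : ℕ} (hN : 0 < N) {x : A} (hx : IsNilpotent x) :
    IsUnit (qexp z t N x) := by
  obtain ⟨n, rfl⟩ : ∃ n, N = n + 1 := ⟨N - 1, by omega⟩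
  rw [qexp, Finset.sum_range_succ', qexpCoeff_zero, one_smul, pow_zero]
  refine IsNilpotent.isUnit_add_one ?_
  have h : ∑ l ∈ Finset.range n, qexpCoeff z t (l + 1) • x ^ (l + 1) =
      x * ∑ l ∈ Finset.range n, qexpCoeff z t (l + 1) • x ^ l := by
    rw [Finset.mul_sum]
    exact Finset.sum_congr rfl fun l _ => by rw [mul_smul_comm, pow_succ']
  rw [h]
  refine Commute.isNilpotent_mul_right ?_ hx
  exact Commute.sum_right _ _ _ fun l _ => ((Commute.refl x).pow_right l).smul_right _

/-- Quantum exponentials of endomorphisms are compatible with intertwiners. -/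
lemma qexp_comp {X Y : Type*} [AddCommGroup X] [Module ℂ X] [AddCommGroup Y] [Module ℂ Y]
    (z t : ℂ) (N : ℕ) {f : X →ₗ[ℂ] Y} {S : Module.End ℂ X} {T : Module.End ℂ Y}
    (h : T ∘ₗ f = f ∘ₗ S) : qexp z t N T ∘ₗ f = f ∘ₗ qexp z t N S := by
  have hpow : ∀ l, (T ^ l) ∘ₗ f = f ∘ₗ (S ^ l) := by
    intro l
    induction l with
    | zero => rfl
    | succ l ih =>
      rw [pow_succ, pow_succ', Module.End.mul_eq_comp, Module.End.mul_eq_comp, LinearMap.comp_assoc,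
        h, ← LinearMap.comp_assoc, ih, LinearMap.comp_assoc, ← Module.End.mul_eq_comp,
        ← Module.End.mul_eq_comp, ← pow_succ, ← pow_succ']
  ext v
  simp only [qexp, LinearMap.comp_apply, LinearMap.sum_apply, LinearMap.smul_apply, map_sum,
    map_smul]
  exact Finset.sum_congr rfl fun l _ => congrArg _ (LinearMap.congr_fun (hpow l) v)

end QExp

/-! ### The coefficients of the `R`-matrix -/

section Scalars

/-- The parameter `-q⁻²` of the quantum exponential. -/
noncomputable def zpar (r : ℕ) : ℂ := -(q r)⁻¹ ^ 2

variable (r : ℕ)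

/-- The integers `(k + 1)_z` at `z = -q⁻²` are the super quantum integers, up to units. -/
lemma geom_sum_zpar [Fact (3 ≤ r)] [Fact (r ≠ 4)] (k : ℕ) :
    ∑ i ∈ Finset.range (k + 1), zpar r ^ i = (-1) ^ k * (q r)⁻¹ ^ k * sqInt r (k + 1) := by
  have hq := q_ne_zero r
  have h1 := one_add_q_sq_ne_zero r
  have h1' : 1 - zpar r ≠ 0 := by
    rw [zpar]
    intro h
    apply h1
    field_simp at h
    linear_combination h
  have h2 := q_add_inv_ne_zero r
  have hg := mul_neg_geom_sum (zpar r) (k + 1)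
  apply mul_left_cancel₀ h1'
  rw [hg, sqInt]
  have h3 : (1 - zpar r) = (q r)⁻¹ * (q r + (q r)⁻¹) := by rw [zpar]; field_simp; ring
  have h4 : zpar r ^ (k + 1) = (-1) ^ (k + 1) * ((q r)⁻¹ ^ (k + 1)) ^ 2 := by
    rw [zpar, neg_pow, ← pow_mul, ← pow_mul, mul_comm 2]
  have h5 : (-q r) ^ (k + 1) = (-1) ^ (k + 1) * q r ^ (k + 1) := neg_pow _ _
  have h6 : (q r)⁻¹ ^ (k + 1) * q r ^ (k + 1) = 1 := by
    rw [← mul_pow, inv_mul_cancel₀ hq, one_pow]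
  have h7 : ((-1 : ℂ) ^ k) * (-1) ^ k = 1 := by rw [← mul_pow]; norm_num
  have h8 : (-1 : ℂ) ^ (k + 1) = -(-1) ^ k := by rw [pow_succ]; ring
  rw [h3, h4, h5, h8]
  calc 1 - -(-1) ^ k * ((q r)⁻¹ ^ (k + 1)) ^ 2
      = ((q r)⁻¹ ^ (k + 1)) * ((-1) ^ k * ((q r)⁻¹ ^ (k + 1) - -(-1) ^ k * q r ^ (k + 1))) := by
        linear_combination (-1 : ℂ) * h6 - ((q r)⁻¹ ^ (k + 1) * q r ^ (k + 1)) * h7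
    _ = _ := by
        rw [pow_succ (q r)⁻¹ k]
        linear_combination (-((q r)⁻¹ ^ k * (q r)⁻¹ * (-1) ^ k)) * mul_div_cancel₀
          ((q r)⁻¹ ^ k * (q r)⁻¹ - -(-1) ^ k * q r ^ (k + 1)) h2

lemma geom_sum_zpar_ne_zero [Fact (3 ≤ r)] [Fact (r ≠ 4)] (k : ℕ) (hk : k + 1 < rbar r) :
    ∑ i ∈ Finset.range (k + 1), zpar r ^ i ≠ 0 := by
  rw [geom_sum_zpar]
  exact mul_ne_zero (mul_ne_zero (pow_ne_zero _ (by norm_num))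
    (pow_ne_zero _ (inv_ne_zero (q_ne_zero r)))) (sqInt_ne_zero k.succ_pos hk)

lemma q_sub_inv_ne_zero [Fact (3 ≤ r)] : q r - (q r)⁻¹ ≠ 0 := by
  intro h
  have hq := q_ne_zero r
  have h2 : q r ^ 2 = 1 := by
    field_simp at h
    linear_combination h
  have := Nat.le_of_dvd (by norm_num) ((q_isPrimitiveRoot r).dvd_of_pow_eq_one _ h2)
  have := (inferInstance : Fact (3 ≤ r)).out
  omega

lemma qpow_natCast (n : ℕ) : qpow r n = q r ^ n := by
  rw [q, qpow, qpow, ← Complex.exp_nat_mul]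
  congr 1
  ring

lemma qpow_triangle (l : ℕ) : qpow r (l * (l - 1) / 2) = ∏ k ∈ Finset.range l, q r ^ k := by
  induction l with
  | zero => simp [qpow_zero]
  | succ l ih =>
    rw [Finset.prod_range_succ, ← ih, ← qpow_natCast, ← qpow_add]
    congr 1
    push_cast
    ring

/-- The coefficients of the `R`-matrix are those of the quantum exponential, up to the Koszul sign
`∏_{k < l} (-1) ^ k` relating `(E ⊗ F) ^ l` and `E ^ l ⊗ F ^ l`. -/
lemma rMatrix_coeff [Fact (3 ≤ r)] [Fact (r ≠ 4)] (l : ℕ) :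
    (-1) ^ l * (qpow r (l * (l - 1) / 2) * (q r - (q r)⁻¹) ^ l / sqFact r l) =
      qexpCoeff (zpar r) (-(q r - (q r)⁻¹)) l * ∏ k ∈ Finset.range l, (-1) ^ k := by
  have hq := q_ne_zero r
  have hpow : ∀ x : ℂ, x ^ l = ∏ k ∈ Finset.range l, x := fun x => by simp
  rw [qpow_triangle, sqFact, qexpCoeff, hpow, hpow, ← Finset.prod_mul_distrib,
    ← Finset.prod_div_distrib, ← Finset.prod_mul_distrib, ← Finset.prod_mul_distrib]
  refine Finset.prod_congr rfl fun k _ => ?_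
  rw [geom_sum_zpar, inv_pow]
  have h7 : ((-1 : ℂ) ^ k) ≠ 0 := pow_ne_zero _ (by norm_num)
  -- If `[k + 1] = 0`, both sides divide by zero and vanish.
  by_cases hn : sqInt r (k + 1) = 0
  · simp [hn]
  · field_simp

end Scalars

/-! ### Koszul signs and homogeneous weight vectors -/

/-- The Koszul sign `(-1) ^ (i j)`, a bicharacter of `ℤ/2`. -/
noncomputable def koszulSign (i j : ZMod 2) : ℂ := ((((-1 : ℤˣ) ^ (i * j) : ℤˣ) : ℤ) : ℂ)

lemma koszulSign_add_left (i i' j : ZMod 2) :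
    koszulSign (i + i') j = koszulSign i j * koszulSign i' j := by
  simp [koszulSign, add_mul, uzpow_add]

lemma koszulSign_add_right (i j j' : ZMod 2) :
    koszulSign i (j + j') = koszulSign i j * koszulSign i j' := by
  simp [koszulSign, mul_add, uzpow_add]

lemma koszulSign_comm (i j : ZMod 2) : koszulSign i j = koszulSign j i := by
  rw [koszulSign, mul_comm, koszulSign]

lemma koszulSign_mul_self (i j : ZMod 2) : koszulSign i j * koszulSign i j = 1 := by
  rw [koszulSign, ← Int.cast_mul, ← Units.val_mul, Int.units_mul_self]
  simp

lemma uzpow_smul_eq_koszulSign {X : Type*} [AddCommGroup X] [Module ℂ X] (i j : ZMod 2) (x : X) :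
    ((-1 : ℤˣ) ^ (i * j)) • x = koszulSign i j • x := by
  rw [koszulSign, Int.cast_smul_eq_zsmul, Units.smul_def]

lemma map_sub_left' {X Y : Type*} [AddCommGroup X] [Module ℂ X] [AddCommGroup Y] [Module ℂ Y]
    (f f' : Module.End ℂ X) (g : Module.End ℂ Y) :
    TensorProduct.map (f - f') g = TensorProduct.map f g - TensorProduct.map f' g := by
  rw [sub_eq_add_neg, TensorProduct.map_add_left, map_neg_left', ← sub_eq_add_neg]

lemma map_sub_right' {X Y : Type*} [AddCommGroup X] [Module ℂ X] [AddCommGroup Y] [Module ℂ Y]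
    (f : Module.End ℂ X) (g g' : Module.End ℂ Y) :
    TensorProduct.map f (g - g') = TensorProduct.map f g - TensorProduct.map f g' := by
  rw [sub_eq_add_neg, TensorProduct.map_add_right, map_neg_right', ← sub_eq_add_neg]

namespace WeightModule

variable {r : ℕ}

/-- The vector `v` is homogeneous of parity `i` and of weight `μ`. -/
structure IsHomog (V : WeightModule r) (i : ZMod 2) (μ : ℂ) (v : V.carrier) : Prop where
  mem : v ∈ V.grading i
  weight : V.ρ Ubar.H v = μ • v

lemma map_par_comm (V : WeightModule r) (a : Ubar r) (v : V.carrier)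
    (ha : a ∈ Ubar.grading r 0) : V.ρ a (V.par v) = V.par (V.ρ a v) :=
  (LinearMap.congr_fun (V.par_ρ_even ha) v).symm

/-- Linear maps which agree on homogeneous weight vectors agree, since `H` is even and
diagonalizable. -/
lemma linearMap_ext_homog {V : WeightModule r} {X : Type*} [AddCommGroup X] [Module ℂ X]
    {f g : V.carrier →ₗ[ℂ] X} (h : ∀ i μ v, V.IsHomog i μ v → f v = g v) : f = g := by
  have hle : ⨆ μ : ℂ, (V.ρ Ubar.H).eigenspace μ ≤ LinearMap.eqLocus f g := by
    refine iSup_le fun μ v hv => ?_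
    rw [Module.End.mem_eigenspace_iff] at hv
    have hp : V.ρ Ubar.H (V.par v) = μ • V.par v := by
      rw [V.map_par_comm _ _ Ubar.H_mem, hv, map_smul]
    have h0 : V.proj 0 v = (2 : ℂ)⁻¹ • (v + V.par v) := by
      rw [par_apply]
      nth_rewrite 2 [← V.proj_add_proj v]
      rw [add_add_sub_cancel, ← two_smul ℂ, smul_smul]
      norm_num
    have h1 : V.proj 1 v = (2 : ℂ)⁻¹ • (v - V.par v) := by
      rw [par_apply]
      nth_rewrite 2 [← V.proj_add_proj v]
      rw [add_sub_sub_cancel, ← two_smul ℂ, smul_smul]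
      norm_num
    rw [LinearMap.mem_eqLocus, ← V.proj_add_proj v, map_add, map_add,
      h 0 μ _ ⟨V.proj_mem 0 v, by rw [h0, map_smul, map_add, hv, hp, ← smul_add, smul_comm]⟩,
      h 1 μ _ ⟨V.proj_mem 1 v, by rw [h1, map_smul, map_sub, hv, hp, ← smul_sub, smul_comm]⟩]
  rw [V.iSup_eigenspace] at hle
  exact LinearMap.ext fun v => hle (Submodule.mem_top (x := v))

lemma tensor_ext_homog {V W : WeightModule r} {X : Type*} [AddCommGroup X] [Module ℂ X]
    {f g : V.carrier ⊗[ℂ] W.carrier →ₗ[ℂ] X}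
    (h : ∀ i j μ ν v w, V.IsHomog i μ v → W.IsHomog j ν w → f (v ⊗ₜ w) = g (v ⊗ₜ w)) :
    f = g := by
  refine TensorProduct.ext (linearMap_ext_homog fun i μ v hv => linearMap_ext_homog
    fun j ν w hw => ?_)
  exact h i j μ ν v w hv hw

lemma tensor₃_ext_homog {U V W : WeightModule r} {X : Type*} [AddCommGroup X] [Module ℂ X]
    {f g : (U.carrier ⊗[ℂ] V.carrier) ⊗[ℂ] W.carrier →ₗ[ℂ] X}
    (h : ∀ i j k lam μ ν u v w, U.IsHomog i lam u → V.IsHomog j μ v → W.IsHomog k ν w →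
      f ((u ⊗ₜ v) ⊗ₜ w) = g ((u ⊗ₜ v) ⊗ₜ w)) : f = g := by
  refine TensorProduct.ext (tensor_ext_homog fun i j lam μ u v hu hv => linearMap_ext_homog
    fun k ν w hw => ?_)
  exact h i j k lam μ ν u v w hu hv hw

lemma Kinv_apply (V : WeightModule r) {μ : ℂ} {v : V.carrier} (h : V.ρ Ubar.H v = μ • v) :
    V.ρ Ubar.Kinv v = qpow r (-μ) • v := by
  have h1 : V.ρ Ubar.Kinv (V.ρ Ubar.K v) = v := by
    rw [← Module.End.mul_apply, ← map_mul, Ubar.KinvK, map_one, Module.End.one_apply]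
  have h2 : qpow r (-μ) * qpow r μ = 1 := by rw [← qpow_add, neg_add_cancel, qpow_zero]
  rw [V.K_apply μ v h, map_smul] at h1
  nth_rewrite 2 [← h1]
  rw [smul_smul, h2, one_smul]

lemma tensor₃_ext_homog' {U V W : WeightModule r} {X : Type*} [AddCommGroup X] [Module ℂ X]
    {f g : U.carrier ⊗[ℂ] (V.carrier ⊗[ℂ] W.carrier) →ₗ[ℂ] X}
    (h : ∀ i j k lam μ ν u v w, U.IsHomog i lam u → V.IsHomog j μ v → W.IsHomog k ν w →
      f (u ⊗ₜ (v ⊗ₜ w)) = g (u ⊗ₜ (v ⊗ₜ w))) : f = g := by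
  refine TensorProduct.ext (linearMap_ext_homog fun i lam u hu => tensor_ext_homog
    fun j k μ ν v w hv hw => ?_)
  exact h i j k lam μ ν u v w hu hv hw

namespace IsHomog

variable {V : WeightModule r} {i : ZMod 2} {μ : ℂ} {v : V.carrier} (h : V.IsHomog i μ v)

include h

lemma par : V.par v = koszulSign 1 i • v := by
  rw [V.par_of_mem h.mem, ← uzpow_smul_eq_koszulSign, one_mul]

lemma K : V.ρ Ubar.K v = qpow r μ • v := V.K_apply μ v h.weight

lemma Kinv : V.ρ Ubar.Kinv v = qpow r (-μ) • v :=
  V.Kinv_apply h.weight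

lemma E : V.IsHomog (1 + i) (μ + 2) (V.ρ Ubar.E v) := by
  refine ⟨V.ρ_mem _ _ _ Ubar.E_mem _ h.mem, ?_⟩
  have h1 := congrArg (fun a => V.ρ a v) (Ubar.HE (r := r))
  simp only [map_sub, map_mul, map_smul, LinearMap.sub_apply, Module.End.mul_apply,
    LinearMap.smul_apply, h.weight] at h1
  rw [add_smul, ← h1]
  abel

lemma F : V.IsHomog (1 + i) (μ - 2) (V.ρ Ubar.F v) := by
  refine ⟨V.ρ_mem _ _ _ Ubar.F_mem _ h.mem, ?_⟩
  have h1 := congrArg (fun a => V.ρ a v) (Ubar.HF (r := r))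
  simp only [map_sub, map_mul, map_smul, LinearMap.sub_apply, Module.End.mul_apply,
    LinearMap.smul_apply, h.weight] at h1
  rw [sub_eq_add_neg, add_smul, ← h1]
  abel

end IsHomog

lemma IsHomog.map {V W : WeightModule r} (f : V ⟶ W) {i : ZMod 2} {μ : ℂ} {v : V.carrier}
    (h : V.IsHomog i μ v) : W.IsHomog i μ (f.toLinearMap v) :=
  ⟨f.map_grading i v h.mem, by rw [← f.map_ρ, h.weight, map_smul]⟩

lemma IsHomog.tmul [Fact (3 ≤ r)] [Fact (r ≠ 4)] {V W : WeightModule r} {i j : ZMod 2} {μ ν : ℂ}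
    {v : V.carrier} {w : W.carrier} (hv : V.IsHomog i μ v) (hw : W.IsHomog j ν w) :
    (tensor V W).IsHomog (i + j) (μ + ν) (v ⊗ₜ[ℂ] w : V.carrier ⊗[ℂ] W.carrier) := by
  refine ⟨mem_tensorGrading V W rfl hv.mem hw.mem, (tensor_H V W v w).trans ?_⟩
  change _ = (μ + ν) • (v ⊗ₜ[ℂ] w)
  rw [hv.weight, hw.weight, add_smul, TensorProduct.smul_tmul', TensorProduct.tmul_smul]

/-! ### The diagonal part of the braiding -/

/-- The invertible operator `τ ∘ Υ`, which is diagonal on homogeneous weight vectors up to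
exchanging the tensor factors. -/
noncomputable def twist (V W : WeightModule r) :
    V.carrier ⊗[ℂ] W.carrier →ₗ[ℂ] W.carrier ⊗[ℂ] V.carrier :=
  koszulSwap V W ∘ₗ upsilon V W

lemma twist_tmul {V W : WeightModule r} {i j : ZMod 2} {μ ν : ℂ} {v : V.carrier} {w : W.carrier}
    (hv : V.IsHomog i μ v) (hw : W.IsHomog j ν w) :
    twist V W (v ⊗ₜ w) = (koszulSign i j * qpow r (μ * ν / 2)) • (w ⊗ₜ[ℂ] v) := by
  rw [twist, LinearMap.comp_apply, upsilon_tmul V W hv.weight hw.weight, map_smul,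
    koszulSwap_tmul V W hv.mem hw.mem, uzpow_smul_eq_koszulSign, smul_smul, mul_comm]

lemma qpow_ne_zero (z : ℂ) : qpow r z ≠ 0 := Complex.exp_ne_zero _

lemma koszulSign_ne_zero (i j : ZMod 2) : koszulSign i j ≠ 0 := fun h => by
  simpa [h] using koszulSign_mul_self i j

/-- The range contains every tensor of homogeneous weight vectors, and the dimensions agree. -/
lemma twist_bijective (V W : WeightModule r) : Function.Bijective (twist V W) := by
  have hs : Function.Surjective (twist V W) := by
    rw [← LinearMap.range_eq_top, ← Submodule.ker_mkQ (LinearMap.range (twist V W)),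
      LinearMap.ker_eq_top]
    refine tensor_ext_homog fun j i ν μ w v hw hv => ?_
    rw [LinearMap.zero_apply, Submodule.mkQ_apply, Submodule.Quotient.mk_eq_zero]
    refine ⟨(koszulSign i j * qpow r (μ * ν / 2))⁻¹ • (v ⊗ₜ w), ?_⟩
    rw [map_smul, twist_tmul hv hw, smul_smul, inv_mul_cancel₀
      (mul_ne_zero (koszulSign_ne_zero i j) (qpow_ne_zero _)), one_smul]
  exact ⟨(LinearMap.injective_iff_surjective_of_finrank_eq_finrank
    (by rw [Module.finrank_tensorProduct, Module.finrank_tensorProduct, mul_comm])).2 hs, hs⟩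

lemma twist_natural {V V' W W' : WeightModule r} (f : V ⟶ V') (g : W ⟶ W') :
    twist V' W' ∘ₗ TensorProduct.map f.toLinearMap g.toLinearMap =
      TensorProduct.map g.toLinearMap f.toLinearMap ∘ₗ twist V W := by
  refine tensor_ext_homog fun i j μ ν v w hv hw => ?_
  rw [LinearMap.comp_apply, LinearMap.comp_apply, TensorProduct.map_tmul, twist_tmul hv hw,
    twist_tmul (hv.map f) (hw.map g), map_smul, TensorProduct.map_tmul]

/-- Conjugation by `τ ∘ Υ` turns `1 ⊗ E` into `E ⊗ K`. -/
lemma twist_comp_par_E (V W : WeightModule r) :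
    twist V W ∘ₗ TensorProduct.map V.par (W.ρ Ubar.E) =
      TensorProduct.map (W.ρ Ubar.E) (V.ρ Ubar.K) ∘ₗ twist V W := by
  refine tensor_ext_homog fun i j μ ν v w hv hw => ?_
  rw [LinearMap.comp_apply, LinearMap.comp_apply, TensorProduct.map_tmul, twist_tmul hv hw,
    hv.par, ← TensorProduct.smul_tmul', map_smul, twist_tmul hv hw.E, map_smul,
    TensorProduct.map_tmul, hv.K, TensorProduct.tmul_smul, smul_smul, smul_smul]
  congr 1
  rw [koszulSign_add_right, koszulSign_comm i 1, mul_assoc (koszulSign i j), ← qpow_add]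
  rw [show μ * (ν + 2) / 2 = μ * ν / 2 + μ by ring]
  linear_combination (koszulSign i j * qpow r (μ * ν / 2 + μ)) * koszulSign_mul_self 1 i

/-- Conjugation by `τ ∘ Υ` turns `E ⊗ K⁻¹` into `1 ⊗ E`. -/
lemma twist_comp_E_Kinv (V W : WeightModule r) :
    twist V W ∘ₗ TensorProduct.map (V.ρ Ubar.E) (W.ρ Ubar.Kinv) =
      TensorProduct.map W.par (V.ρ Ubar.E) ∘ₗ twist V W := by
  refine tensor_ext_homog fun i j μ ν v w hv hw => ?_
  rw [LinearMap.comp_apply, LinearMap.comp_apply, TensorProduct.map_tmul, twist_tmul hv hw,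
    hw.Kinv, TensorProduct.tmul_smul, map_smul, twist_tmul hv.E hw, map_smul,
    TensorProduct.map_tmul, hw.par, ← TensorProduct.smul_tmul', smul_smul, smul_smul]
  congr 1
  rw [koszulSign_add_left, mul_left_comm, ← qpow_add,
    show -ν + (μ + 2) * ν / 2 = μ * ν / 2 by ring]
  ring

/-- Conjugation by `τ ∘ Υ` turns `F ⊗ 1` into `K⁻¹ ⊗ F`. -/
lemma twist_comp_F_one (V W : WeightModule r) :
    twist V W ∘ₗ TensorProduct.map (V.ρ Ubar.F) 1 =
      TensorProduct.map (W.ρ Ubar.Kinv * W.par) (V.ρ Ubar.F) ∘ₗ twist V W := by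
  refine tensor_ext_homog fun i j μ ν v w hv hw => ?_
  rw [LinearMap.comp_apply, LinearMap.comp_apply, TensorProduct.map_tmul, twist_tmul hv hw,
    Module.End.one_apply, twist_tmul hv.F hw, map_smul, TensorProduct.map_tmul,
    Module.End.mul_apply, hw.par, map_smul, hw.Kinv, ← TensorProduct.smul_tmul',
    ← TensorProduct.smul_tmul', smul_smul, smul_smul]
  congr 1
  rw [koszulSign_add_left, show (μ - 2) * ν / 2 = μ * ν / 2 + -ν by ring, qpow_add]
  ring

/-- Conjugation by `τ ∘ Υ` turns `K ⊗ F` into `F ⊗ 1`. -/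
lemma twist_comp_K_par_F (V W : WeightModule r) :
    twist V W ∘ₗ TensorProduct.map (V.ρ Ubar.K * V.par) (W.ρ Ubar.F) =
      TensorProduct.map (W.ρ Ubar.F) 1 ∘ₗ twist V W := by
  refine tensor_ext_homog fun i j μ ν v w hv hw => ?_
  rw [LinearMap.comp_apply, LinearMap.comp_apply, TensorProduct.map_tmul, twist_tmul hv hw,
    Module.End.mul_apply, hv.par, map_smul, hv.K, ← TensorProduct.smul_tmul',
    ← TensorProduct.smul_tmul', map_smul, map_smul, twist_tmul hv hw.F, map_smul,
    TensorProduct.map_tmul, Module.End.one_apply, smul_smul, smul_smul]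
  congr 1
  rw [koszulSign_add_right, koszulSign_comm i 1,
    show μ * (ν - 2) / 2 = μ * ν / 2 + -μ by ring, qpow_add]
  have h2 : qpow r (-μ) * qpow r μ = 1 := by rw [← qpow_add, neg_add_cancel, qpow_zero]
  linear_combination (koszulSign i j * qpow r (μ * ν / 2)) * (koszulSign 1 i * koszulSign 1 i) * h2
    + (koszulSign i j * qpow r (μ * ν / 2)) * koszulSign_mul_self 1 i

/-! ### The operator `E ⊗ F` -/

/-- The action of `E ⊗ F` on `V ⊗ W`, which includes the Koszul sign. -/
noncomputable def theta (V W : WeightModule r) : Module.End ℂ (V.carrier ⊗[ℂ] W.carrier) :=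
  TensorProduct.map (V.ρ Ubar.E * V.par) (W.ρ Ubar.F)

/-- The quantum exponential of `-(q - q⁻¹) x` in the parameter `-q⁻²`, truncated to its first `rbar`
terms. -/
noncomputable def rExp {A : Type*} [Ring A] [Algebra ℂ A] (r : ℕ) (x : A) : A :=
  qexp (zpar r) (-(q r - (q r)⁻¹)) (rbar r) x

lemma map_rExp_one {X Y : Type*} [AddCommGroup X] [Module ℂ X] [AddCommGroup Y] [Module ℂ Y]
    (f : Module.End ℂ X) :
    TensorProduct.map (rExp r f) (1 : Module.End ℂ Y) = rExp r (TensorProduct.map f 1) := by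
  have h := map_qexp (Module.End.rTensorAlgHom ℂ X Y) (zpar r) (-(q r - (q r)⁻¹)) (rbar r) f
  exact h

lemma map_one_rExp {X Y : Type*} [AddCommGroup X] [Module ℂ X] [AddCommGroup Y] [Module ℂ Y]
    (f : Module.End ℂ Y) :
    TensorProduct.map (1 : Module.End ℂ X) (rExp r f) = rExp r (TensorProduct.map 1 f) := by
  have h := map_qexp (Module.End.lTensorAlgHom ℂ Y X) (zpar r) (-(q r - (q r)⁻¹)) (rbar r) f
  exact h

lemma rExp_comp {X Y : Type*} [AddCommGroup X] [Module ℂ X] [AddCommGroup Y] [Module ℂ Y]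
    {f : X →ₗ[ℂ] Y} {S : Module.End ℂ X} {T : Module.End ℂ Y} (h : T ∘ₗ f = f ∘ₗ S) :
    rExp r T ∘ₗ f = f ∘ₗ rExp r S :=
  qexp_comp _ _ _ h

section Relations

variable (V : WeightModule r)

lemma ρ_K_E : V.ρ Ubar.K * V.ρ Ubar.E = (q r) ^ 2 • (V.ρ Ubar.E * V.ρ Ubar.K) := by
  rw [← map_mul, Ubar.KE, map_smul, map_mul]

lemma ρ_K_F : V.ρ Ubar.K * V.ρ Ubar.F = ((q r)⁻¹) ^ 2 • (V.ρ Ubar.F * V.ρ Ubar.K) := by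
  rw [← map_mul, Ubar.KF, map_smul, map_mul]

lemma ρ_E_Kinv : V.ρ Ubar.E * V.ρ Ubar.Kinv = (q r) ^ 2 • (V.ρ Ubar.Kinv * V.ρ Ubar.E) := by
  rw [← map_mul, Ubar.EKinv, map_smul, map_mul]

lemma ρ_F_Kinv : V.ρ Ubar.F * V.ρ Ubar.Kinv = ((q r)⁻¹) ^ 2 • (V.ρ Ubar.Kinv * V.ρ Ubar.F) := by
  rw [← map_mul, Ubar.FKinv, map_smul, map_mul]

lemma ρ_E_K : V.ρ Ubar.E * V.ρ Ubar.K = ((q r)⁻¹) ^ 2 • (V.ρ Ubar.K * V.ρ Ubar.E) := by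
  rw [ρ_K_E, smul_smul, ← mul_pow, inv_mul_cancel₀ (q_ne_zero r), one_pow, one_smul]

lemma ρ_Kinv_E : V.ρ Ubar.Kinv * V.ρ Ubar.E = ((q r)⁻¹) ^ 2 • (V.ρ Ubar.E * V.ρ Ubar.Kinv) := by
  rw [ρ_E_Kinv, smul_smul, ← mul_pow, inv_mul_cancel₀ (q_ne_zero r), one_pow, one_smul]

lemma ρ_E_F [Fact (3 ≤ r)] :
    (q r - (q r)⁻¹) • (V.ρ Ubar.E * V.ρ Ubar.F + V.ρ Ubar.F * V.ρ Ubar.E) =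
    V.ρ Ubar.K - V.ρ Ubar.Kinv := by
  rw [← map_mul, ← map_mul, ← map_add, Ubar.EF, map_smul, smul_smul,
    mul_inv_cancel₀ (q_sub_inv_ne_zero r), one_smul, map_sub]

lemma par_E : V.par * V.ρ Ubar.E = -(V.ρ Ubar.E * V.par) := V.par_ρ_odd Ubar.E_mem
lemma par_F : V.par * V.ρ Ubar.F = -(V.ρ Ubar.F * V.par) := V.par_ρ_odd Ubar.F_mem
lemma par_K : V.par * V.ρ Ubar.K = V.ρ Ubar.K * V.par := V.par_ρ_even Ubar.K_mem
lemma par_Kinv : V.par * V.ρ Ubar.Kinv = V.ρ Ubar.Kinv * V.par := V.par_ρ_even Ubar.Kinv_mem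

/-- The Koszul sign `∏_{k < l} (-1) ^ k` relating `(E ⊗ F) ^ l` and `E ^ l ⊗ F ^ l`. -/
lemma E_par_pow (l : ℕ) : (V.ρ Ubar.E * V.par) ^ l =
    (∏ k ∈ Finset.range l, (-1 : ℂ) ^ k) • (V.ρ Ubar.E ^ l * V.par ^ l) := by
  have hp : ∀ l, V.par ^ l * V.ρ Ubar.E = (-1 : ℂ) ^ l • (V.ρ Ubar.E * V.par ^ l) := by
    intro l
    induction l with
    | zero => simp
    | succ l ih =>
      rw [pow_succ, mul_assoc, par_E, mul_neg, ← mul_assoc, ih, pow_succ (-1 : ℂ), mul_neg_one,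
        neg_smul, smul_mul_assoc, mul_assoc]
  induction l with
  | zero => simp
  | succ l ih =>
    rw [pow_succ, ih, Finset.prod_range_succ, smul_mul_assoc, mul_assoc, ← mul_assoc _ (V.ρ _), hp,
      smul_mul_assoc, mul_smul_comm, smul_smul, mul_assoc, ← pow_succ, ← mul_assoc, ← pow_succ]

lemma ρ_E_pow : V.ρ Ubar.E ^ rbar r = 0 := by rw [← map_pow, Ubar.E_pow, map_zero]
lemma ρ_F_pow : V.ρ Ubar.F ^ rbar r = 0 := by rw [← map_pow, Ubar.F_pow, map_zero]

lemma E_par_pow_eq_zero {l : ℕ} (h : rbar r ≤ l) : (V.ρ Ubar.E * V.par) ^ l = 0 := by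
  rw [E_par_pow, pow_eq_zero_of_le h V.ρ_E_pow, zero_mul, smul_zero]

end Relations

/-- The truncated `R`-matrix is the quantum exponential of `-(q - q⁻¹) E ⊗ F`. -/
lemma act_rMatrix [Fact (3 ≤ r)] [Fact (r ≠ 4)] (V W : WeightModule r) :
    act V W (rMatrix r) = rExp r (theta V W) := by
  rw [rMatrix, map_sum, rExp, qexp]
  refine Finset.sum_congr rfl fun l _ => ?_
  rw [map_smul, rMatrix_coeff, act_tm, map_pow, map_pow, actLeft_apply,
    actRight_of_odd V W Ubar.F_mem, theta, TensorProduct.map_pow, TensorProduct.map_pow,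
    TensorProduct.map_pow, one_pow, E_par_pow, ← TensorProduct.map_mul, one_mul,
    TensorProduct.map_smul_left, smul_smul]

lemma braidingMap_eq [Fact (3 ≤ r)] [Fact (r ≠ 4)] (V W : WeightModule r) :
    braidingMap V W = twist V W ∘ₗ rExp r (theta V W) := by
  rw [braidingMap, act_rMatrix, twist, LinearMap.comp_assoc]

lemma theta_pow_eq_zero (V W : WeightModule r) : theta V W ^ rbar r = 0 := by
  rw [theta, TensorProduct.map_pow, ρ_F_pow, TensorProduct.map_zero_right]

lemma braidingMap_bijective [Fact (3 ≤ r)] [Fact (r ≠ 4)] (V W : WeightModule r) :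
    Function.Bijective (braidingMap V W) := by
  rw [braidingMap_eq, LinearMap.coe_comp]
  exact (twist_bijective V W).comp ((Module.End.isUnit_iff _).1
    (isUnit_qexp _ _ (rbar_pos r) ⟨_, theta_pow_eq_zero V W⟩))

lemma braidingMap_natural [Fact (3 ≤ r)] [Fact (r ≠ 4)] {V V' W W' : WeightModule r}
    (f : V ⟶ V') (g : W ⟶ W') :
    braidingMap V' W' ∘ₗ TensorProduct.map f.toLinearMap g.toLinearMap =
      TensorProduct.map g.toLinearMap f.toLinearMap ∘ₗ braidingMap V W := by
  have h : theta V' W' ∘ₗ TensorProduct.map f.toLinearMap g.toLinearMap =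
      TensorProduct.map f.toLinearMap g.toLinearMap ∘ₗ theta V W := by
    refine TensorProduct.ext' fun v w => ?_
    simp only [theta, LinearMap.comp_apply, TensorProduct.map_tmul, Module.End.mul_apply,
      f.map_ρ, g.map_ρ, f.map_par]
  rw [braidingMap_eq, braidingMap_eq, LinearMap.comp_assoc, rExp_comp h,
    ← LinearMap.comp_assoc, twist_natural, LinearMap.comp_assoc]

/-! ### Compatibility with the action -/

/-- A linear map of weight modules commutes with `K⁻¹` and `K` as soon as it commutes with `H`. -/
lemma comp_ρ_K_of_comp_ρ_H {V W : WeightModule r} {f : V.carrier →ₗ[ℂ] W.carrier}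
    (h : ∀ v, f (V.ρ Ubar.H v) = W.ρ Ubar.H (f v)) :
    (∀ v, f (V.ρ Ubar.K v) = W.ρ Ubar.K (f v)) ∧
      ∀ v, f (V.ρ Ubar.Kinv v) = W.ρ Ubar.Kinv (f v) := by
  have hw : ∀ i μ v, V.IsHomog i μ v → W.ρ Ubar.H (f v) = μ • f v := fun i μ v hv => by
    rw [← h, hv.weight, map_smul]
  refine ⟨LinearMap.congr_fun (f := f ∘ₗ V.ρ Ubar.K) (g := W.ρ Ubar.K ∘ₗ f)
    (linearMap_ext_homog fun i μ v hv => ?_),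
    LinearMap.congr_fun (f := f ∘ₗ V.ρ Ubar.Kinv) (g := W.ρ Ubar.Kinv ∘ₗ f)
    (linearMap_ext_homog fun i μ v hv => ?_)⟩
  · rw [LinearMap.comp_apply, LinearMap.comp_apply, hv.K, map_smul, W.K_apply _ _ (hw i μ v hv)]
  · rw [LinearMap.comp_apply, LinearMap.comp_apply, hv.Kinv, map_smul,
      W.Kinv_apply (hw i μ v hv)]

section Intertwine

lemma E_par_mul_Kinv_par (V : WeightModule r) :
    (V.ρ Ubar.E * V.par) * (V.ρ Ubar.Kinv * V.par) = V.ρ Ubar.E * V.ρ Ubar.Kinv := by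
  rw [mul_assoc, ← mul_assoc V.par, par_Kinv, mul_assoc _ V.par, V.par_par, mul_one]

lemma E_par_mul_K_par (V : WeightModule r) :
    (V.ρ Ubar.E * V.par) * (V.ρ Ubar.K * V.par) = V.ρ Ubar.E * V.ρ Ubar.K := by
  rw [mul_assoc, ← mul_assoc V.par, par_K, mul_assoc _ V.par, V.par_par, mul_one]

lemma mul_par_mul_E_par (V : WeightModule r) (x : Module.End ℂ V.carrier) :
    (x * V.par) * (V.ρ Ubar.E * V.par) = -(x * V.ρ Ubar.E) := by
  rw [mul_assoc, ← mul_assoc V.par, par_E, neg_mul, mul_assoc _ V.par, V.par_par, mul_one,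
    mul_neg]

variable [Fact (3 ≤ r)] (V W : WeightModule r)

lemma E_par_pow_mul_E : (V.ρ Ubar.E * V.par) ^ (rbar r - 1) * V.ρ Ubar.E = 0 := by
  have hN : rbar r - 1 + 1 = rbar r := Nat.sub_add_cancel (rbar_pos r)
  rw [← mul_one (_ * V.ρ Ubar.E), ← V.par_par, ← mul_assoc, mul_assoc _ (V.ρ Ubar.E), ← pow_succ,
    hN, V.E_par_pow_eq_zero le_rfl, zero_mul]

lemma E_mul_E_par_pow : V.ρ Ubar.E * (V.ρ Ubar.E * V.par) ^ (rbar r - 1) = 0 := by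
  have hN : rbar r - 1 + 1 = rbar r := Nat.sub_add_cancel (rbar_pos r)
  rw [← one_mul (V.ρ Ubar.E * _), ← V.par_par, ← mul_assoc, mul_assoc V.par, par_E, mul_neg,
    neg_mul, mul_assoc, ← pow_succ', hN, V.E_par_pow_eq_zero le_rfl, mul_zero, neg_zero]

variable [Fact (r ≠ 4)]

/-- `R̃ Δ(E) = (1 ⊗ E + E ⊗ K⁻¹) R̃` on `V ⊗ W`. -/
lemma rExp_intertwine_E : rExp r (theta V W) *
      (TensorProduct.map V.par (W.ρ Ubar.E) + TensorProduct.map (V.ρ Ubar.E) (W.ρ Ubar.K)) =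
    (TensorProduct.map V.par (W.ρ Ubar.E) + TensorProduct.map (V.ρ Ubar.E) (W.ρ Ubar.Kinv)) *
      rExp r (theta V W) := by
  refine qexp_intertwine (rbar_pos r) (q_sub_inv_ne_zero r) (geom_sum_zpar_ne_zero r) ?_ ?_ ?_ ?_ ?_
  · rw [theta, ← TensorProduct.map_mul, ← TensorProduct.map_mul, ← mul_assoc, par_E, neg_mul,
      mul_assoc, V.par_par, mul_one, map_neg_left', ← neg_add', ← TensorProduct.map_add_right,
      smul_neg, ← TensorProduct.map_smul_right, ρ_E_F, map_sub_right', neg_sub]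
  · rw [theta, ← TensorProduct.map_mul, ← TensorProduct.map_mul, mul_assoc _ V.par, par_E, mul_neg,
      map_neg_left', ρ_K_F, TensorProduct.map_smul_right, zpar, neg_smul, smul_neg, neg_neg]
  · rw [theta, ← TensorProduct.map_mul, ← TensorProduct.map_mul, mul_assoc _ V.par, par_E, mul_neg,
      map_neg_left', ρ_F_Kinv, TensorProduct.map_smul_right, zpar, neg_smul]
  · rw [theta, TensorProduct.map_pow, ← TensorProduct.map_mul, E_par_pow_mul_E,
      TensorProduct.map_zero_left]
  · rw [theta, TensorProduct.map_pow, ← TensorProduct.map_mul, E_mul_E_par_pow,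
      TensorProduct.map_zero_left]

/-- `R̃ Δ(F) = (F ⊗ 1 + K ⊗ F) R̃` on `V ⊗ W`. -/
lemma rExp_intertwine_F : rExp r (theta V W) *
      (TensorProduct.map (V.ρ Ubar.F) 1 + TensorProduct.map (V.ρ Ubar.Kinv * V.par) (W.ρ Ubar.F)) =
    (TensorProduct.map (V.ρ Ubar.F) 1 + TensorProduct.map (V.ρ Ubar.K * V.par) (W.ρ Ubar.F)) *
      rExp r (theta V W) := by
  have hN : rbar r - 1 + 1 = rbar r := Nat.sub_add_cancel (rbar_pos r)
  refine qexp_intertwine (rbar_pos r) (q_sub_inv_ne_zero r) (geom_sum_zpar_ne_zero r) ?_ ?_ ?_ ?_ ?_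
  · rw [theta, ← TensorProduct.map_mul, ← TensorProduct.map_mul, one_mul, mul_one,
      ← map_sub_left', mul_assoc _ V.par, par_F, mul_neg, sub_neg_eq_add, ← mul_assoc,
      ← mul_assoc, ← add_mul, add_comm, ← TensorProduct.map_smul_left, ← smul_mul_assoc, ρ_E_F,
      sub_mul, map_sub_left']
  · rw [theta, ← TensorProduct.map_mul, ← TensorProduct.map_mul, E_par_mul_Kinv_par,
      mul_par_mul_E_par, ρ_Kinv_E, map_neg_left',
      TensorProduct.map_smul_left, zpar, neg_smul]
  · rw [theta, ← TensorProduct.map_mul, ← TensorProduct.map_mul, E_par_mul_K_par,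
      mul_par_mul_E_par, ρ_E_K, map_neg_left',
      TensorProduct.map_smul_left, zpar, neg_smul, smul_neg, neg_neg]
  · rw [theta, TensorProduct.map_pow, ← TensorProduct.map_mul, ← pow_succ, hN, ρ_F_pow,
      TensorProduct.map_zero_right]
  · rw [theta, TensorProduct.map_pow, ← TensorProduct.map_mul, ← pow_succ', hN, ρ_F_pow,
      TensorProduct.map_zero_right]

lemma braidingMap_E : braidingMap V W ∘ₗ tensorρ V W Ubar.E =
    tensorρ W V Ubar.E ∘ₗ braidingMap V W := by
  rw [braidingMap_eq, tensorρ_E, tensorρ_E, LinearMap.comp_assoc, ← Module.End.mul_eq_comp,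
    rExp_intertwine_E, Module.End.mul_eq_comp, ← LinearMap.comp_assoc, LinearMap.comp_add,
    twist_comp_par_E, twist_comp_E_Kinv, ← LinearMap.add_comp, add_comm, LinearMap.comp_assoc]

lemma braidingMap_F : braidingMap V W ∘ₗ tensorρ V W Ubar.F =
    tensorρ W V Ubar.F ∘ₗ braidingMap V W := by
  rw [braidingMap_eq, tensorρ_F, tensorρ_F, LinearMap.comp_assoc, add_comm,
    ← Module.End.mul_eq_comp, rExp_intertwine_F, Module.End.mul_eq_comp, ← LinearMap.comp_assoc,
    LinearMap.comp_add, twist_comp_F_one, twist_comp_K_par_F, ← LinearMap.add_comp,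
    LinearMap.comp_assoc]

lemma braidingMap_H : braidingMap V W ∘ₗ tensorρ V W Ubar.H =
    tensorρ W V Ubar.H ∘ₗ braidingMap V W := by
  have ht : twist V W ∘ₗ tensorρ V W Ubar.H = tensorρ W V Ubar.H ∘ₗ twist V W := by
    refine tensor_ext_homog fun i j μ ν v w hv hw => ?_
    have h1 : tensorρ V W Ubar.H (v ⊗ₜ w) = (μ + ν) • (v ⊗ₜ w) := (hv.tmul hw).weight
    have h2 : tensorρ W V Ubar.H (w ⊗ₜ v) = (ν + μ) • (w ⊗ₜ v) := (hw.tmul hv).weight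
    rw [LinearMap.comp_apply, LinearMap.comp_apply, h1, map_smul, twist_tmul hv hw, map_smul, h2,
      smul_comm, add_comm]
  -- `E ⊗ F` has weight zero.
  have hc : tensorρ V W Ubar.H ∘ₗ theta V W = theta V W ∘ₗ tensorρ V W Ubar.H := by
    refine tensor_ext_homog fun i j μ ν v w hv hw => ?_
    have h1 : tensorρ V W Ubar.H (v ⊗ₜ w) = (μ + ν) • (v ⊗ₜ w) := (hv.tmul hw).weight
    have h2 : tensorρ V W Ubar.H (V.ρ Ubar.E v ⊗ₜ W.ρ Ubar.F w) =
      (μ + 2 + (ν - 2)) • (V.ρ Ubar.E v ⊗ₜ W.ρ Ubar.F w) := (hv.E.tmul hw.F).weight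
    rw [LinearMap.comp_apply, LinearMap.comp_apply, h1, map_smul, theta, TensorProduct.map_tmul,
      Module.End.mul_apply, hv.par, map_smul, ← TensorProduct.smul_tmul', map_smul, h2, smul_comm]
    congr 1
    ring
  rw [braidingMap_eq, LinearMap.comp_assoc]
  rw [rExp_comp hc.symm, ← LinearMap.comp_assoc, ht, LinearMap.comp_assoc]

lemma braidingMap_par : braidingMap V W ∘ₗ TensorProduct.map V.par W.par =
    TensorProduct.map W.par V.par ∘ₗ braidingMap V W := by
  have ht : twist V W ∘ₗ TensorProduct.map V.par W.par =
      TensorProduct.map W.par V.par ∘ₗ twist V W := by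
    refine tensor_ext_homog fun i j μ ν v w hv hw => ?_
    simp only [LinearMap.comp_apply, twist_tmul hv hw, map_smul, TensorProduct.map_tmul, hv.par,
      hw.par, TensorProduct.tmul_smul, ← TensorProduct.smul_tmul', smul_smul]
    congr 1
    ring
  have hc : theta V W ∘ₗ TensorProduct.map V.par W.par =
      TensorProduct.map V.par W.par ∘ₗ theta V W := by
    rw [← Module.End.mul_eq_comp, ← Module.End.mul_eq_comp, theta, ← TensorProduct.map_mul,
      ← TensorProduct.map_mul, ← mul_assoc, par_E, par_F, neg_mul, map_neg_left', map_neg_right',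
      neg_neg]
  rw [braidingMap_eq, LinearMap.comp_assoc]
  rw [rExp_comp hc, ← LinearMap.comp_assoc, ht, LinearMap.comp_assoc]

/-- The braiding as an isomorphism of weight modules. -/
noncomputable def braidingIso (V W : WeightModule r) : tensor V W ≅ tensor W V :=
  isoOfEquiv (V := tensor V W) (W := tensor W V)
    (LinearEquiv.ofBijective (braidingMap V W) (braidingMap_bijective V W))
    (LinearMap.congr_fun (braidingMap_H V W))
    (comp_ρ_K_of_comp_ρ_H (V := tensor V W) (W := tensor W V) (f := braidingMap V W)
      (LinearMap.congr_fun (braidingMap_H V W))).1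
    (comp_ρ_K_of_comp_ρ_H (V := tensor V W) (W := tensor W V) (f := braidingMap V W)
      (LinearMap.congr_fun (braidingMap_H V W))).2
    (LinearMap.congr_fun (braidingMap_E V W))
    (LinearMap.congr_fun (braidingMap_F V W))
    (by
      rw [tensor_par, tensor_par]
      exact LinearMap.congr_fun (braidingMap_par V W))

end Intertwine

/-! ### The hexagon axioms -/

section Hexagon

variable (U V W : WeightModule r)

/-- The summand `E ⊗ K⁻¹ ⊗ F` of `(id ⊗ Δ)(E ⊗ F) = E ⊗ K⁻¹ ⊗ F + E ⊗ F ⊗ 1`. -/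
noncomputable def thetaFwd₁₃ : Module.End ℂ ((U.carrier ⊗[ℂ] V.carrier) ⊗[ℂ] W.carrier) :=
  TensorProduct.map (TensorProduct.map (U.ρ Ubar.E * U.par) (V.ρ Ubar.Kinv * V.par)) (W.ρ Ubar.F)

/-- The summand `E ⊗ K ⊗ F` of `(Δ ⊗ id)(E ⊗ F) = E ⊗ K ⊗ F + 1 ⊗ E ⊗ F`. -/
noncomputable def thetaRev₁₃ : Module.End ℂ (U.carrier ⊗[ℂ] (V.carrier ⊗[ℂ] W.carrier)) :=
  TensorProduct.map (U.ρ Ubar.E * U.par) (TensorProduct.map (V.ρ Ubar.K * V.par) (W.ρ Ubar.F))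

/-- Moving `E ⊗ F` past the diagonal part of the braiding of the first two factors produces the
factor `K⁻¹` of `(id ⊗ Δ)(E ⊗ F)`. -/
lemma theta_comp_twist_fwd :
    TensorProduct.map 1 (theta U W) ∘ₗ
      (TensorProduct.assoc ℂ V.carrier U.carrier W.carrier).toLinearMap ∘ₗ
        TensorProduct.map (twist U V) LinearMap.id =
    ((TensorProduct.assoc ℂ V.carrier U.carrier W.carrier).toLinearMap ∘ₗ
        TensorProduct.map (twist U V) LinearMap.id) ∘ₗ thetaFwd₁₃ U V W := by
  refine tensor₃_ext_homog fun i j k lam μ ν u v w hu hv hw => ?_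
  simp only [LinearMap.comp_apply, thetaFwd₁₃, theta, TensorProduct.map_tmul, twist_tmul hu hv,
    Module.End.mul_apply, hu.par, hv.par, hv.Kinv, map_smul, ← TensorProduct.smul_tmul',
    TensorProduct.tmul_smul, twist_tmul hu.E hv, LinearEquiv.coe_coe, TensorProduct.assoc_tmul,
    Module.End.one_apply, LinearMap.id_apply, smul_smul]
  congr 1
  rw [koszulSign_add_left, show lam * μ / 2 = -μ + (lam + 2) * μ / 2 by ring, qpow_add]
  linear_combination (-(koszulSign i j * qpow r (-μ) * qpow r ((lam + 2) * μ / 2) *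
    koszulSign 1 i)) * koszulSign_mul_self 1 j

/-- Moving `E ⊗ F` past the diagonal part of the braiding of the last two factors produces the
factor `K` of `(Δ ⊗ id)(E ⊗ F)`. -/
lemma theta_comp_twist_rev :
    TensorProduct.map (theta U W) 1 ∘ₗ
      (TensorProduct.assoc ℂ U.carrier W.carrier V.carrier).symm.toLinearMap ∘ₗ
        TensorProduct.map LinearMap.id (twist V W) =
    ((TensorProduct.assoc ℂ U.carrier W.carrier V.carrier).symm.toLinearMap ∘ₗ
        TensorProduct.map LinearMap.id (twist V W)) ∘ₗ thetaRev₁₃ U V W := by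
  refine tensor₃_ext_homog' fun i j k lam μ ν u v w hu hv hw => ?_
  simp only [LinearMap.comp_apply, thetaRev₁₃, theta, TensorProduct.map_tmul, twist_tmul hv hw,
    Module.End.mul_apply, hu.par, hv.par, hv.K, map_smul, ← TensorProduct.smul_tmul',
    TensorProduct.tmul_smul, twist_tmul hv hw.F, LinearEquiv.coe_coe, TensorProduct.assoc_symm_tmul,
    Module.End.one_apply, LinearMap.id_apply, smul_smul]
  congr 1
  rw [koszulSign_add_right, koszulSign_comm j 1, show μ * ν / 2 = μ + μ * (ν - 2) / 2 by ring,
    qpow_add]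
  linear_combination (-(koszulSign j k * qpow r μ * qpow r (μ * (ν - 2) / 2) *
    koszulSign 1 i)) * koszulSign_mul_self 1 j

variable [Fact (3 ≤ r)] [Fact (r ≠ 4)]

/-- `(id ⊗ Δ)(E ⊗ F)`, as an operator on the underlying triple tensor product. -/
noncomputable def thetaFwd : Module.End ℂ (U.carrier ⊗[ℂ] (V.carrier ⊗[ℂ] W.carrier)) :=
  theta U (tensor V W)

/-- `(Δ ⊗ id)(E ⊗ F)`, as an operator on the underlying triple tensor product. -/
noncomputable def thetaRev : Module.End ℂ ((U.carrier ⊗[ℂ] V.carrier) ⊗[ℂ] W.carrier) :=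
  theta (tensor U V) W

/-- The diagonal part of `c_{U, V ⊗ W}`, on the underlying triple tensor product. -/
noncomputable def twistFwd :
    U.carrier ⊗[ℂ] (V.carrier ⊗[ℂ] W.carrier) →ₗ[ℂ] (V.carrier ⊗[ℂ] W.carrier) ⊗[ℂ] U.carrier :=
  twist U (tensor V W)

/-- The diagonal part of `c_{U ⊗ V, W}`, on the underlying triple tensor product. -/
noncomputable def twistRev :
    (U.carrier ⊗[ℂ] V.carrier) ⊗[ℂ] W.carrier →ₗ[ℂ] W.carrier ⊗[ℂ] (U.carrier ⊗[ℂ] V.carrier) :=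
  twist (tensor U V) W

lemma thetaFwd_comp_assoc : thetaFwd U V W ∘ₗ
      (TensorProduct.assoc ℂ U.carrier V.carrier W.carrier).toLinearMap =
    (TensorProduct.assoc ℂ U.carrier V.carrier W.carrier).toLinearMap ∘ₗ
      (thetaFwd₁₃ U V W + TensorProduct.map (theta U V) 1) := by
  refine TensorProduct.ext_threefold fun u v w => ?_
  change (U.ρ Ubar.E (U.par u)) ⊗ₜ[ℂ] (tensorρ V W Ubar.F (v ⊗ₜ[ℂ] w)) = _
  rw [tensorρ_F]
  simp [thetaFwd₁₃, theta, TensorProduct.tmul_add]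

lemma thetaRev_comp_assoc_symm : thetaRev U V W ∘ₗ
      (TensorProduct.assoc ℂ U.carrier V.carrier W.carrier).symm.toLinearMap =
    (TensorProduct.assoc ℂ U.carrier V.carrier W.carrier).symm.toLinearMap ∘ₗ
      (thetaRev₁₃ U V W + TensorProduct.map 1 (theta V W)) := by
  refine TensorProduct.ext (LinearMap.ext fun u => TensorProduct.ext' fun v w => ?_)
  have hp : (tensor U V).par (u ⊗ₜ[ℂ] v : U.carrier ⊗[ℂ] V.carrier) =
    (U.par u ⊗ₜ[ℂ] V.par v : U.carrier ⊗[ℂ] V.carrier) := tensor_par_tmul U V u v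
  change (tensorρ U V Ubar.E ((tensor U V).par (u ⊗ₜ[ℂ] v : U.carrier ⊗[ℂ] V.carrier))) ⊗ₜ[ℂ]
    W.ρ Ubar.F w = _
  rw [hp, tensorρ_E]
  have h := LinearMap.congr_fun U.par_par u
  rw [Module.End.mul_apply, Module.End.one_apply] at h
  simp [thetaRev₁₃, theta, TensorProduct.add_tmul, h, add_comm]

/-- The two summands of `(id ⊗ Δ)(E ⊗ F)` skew-commute, so the quantum exponential factors. -/
lemma rExp_fwd : rExp r (thetaFwd₁₃ U V W + TensorProduct.map (theta U V) 1) =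
    rExp r (thetaFwd₁₃ U V W) * TensorProduct.map (rExp r (theta U V)) 1 := by
  rw [map_rExp_one]
  refine qexp_add _ (geom_sum_zpar_ne_zero r) ?_ fun i j hij => ?_
  · rw [thetaFwd₁₃, theta, ← TensorProduct.map_mul, ← TensorProduct.map_mul,
      ← TensorProduct.map_mul, ← TensorProduct.map_mul, mul_assoc _ V.par, par_F, mul_neg,
      map_neg_right', map_neg_left', one_mul, mul_one, ← mul_assoc (V.ρ Ubar.F), ρ_F_Kinv, zpar,
      smul_mul_assoc,
      TensorProduct.map_smul_right, TensorProduct.map_smul_left, mul_assoc (V.ρ Ubar.Kinv)]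
    module
  · rw [thetaFwd₁₃, theta, TensorProduct.map_pow, TensorProduct.map_pow, TensorProduct.map_pow,
      TensorProduct.map_pow, ← TensorProduct.map_mul, ← TensorProduct.map_mul, ← pow_add,
      U.E_par_pow_eq_zero hij, TensorProduct.map_zero_left, TensorProduct.map_zero_left]

/-- The two summands of `(Δ ⊗ id)(E ⊗ F)` skew-commute, so the quantum exponential factors. -/
lemma rExp_rev : rExp r (thetaRev₁₃ U V W + TensorProduct.map 1 (theta V W)) =
    rExp r (thetaRev₁₃ U V W) * TensorProduct.map 1 (rExp r (theta V W)) := by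
  rw [map_one_rExp]
  refine qexp_add _ (geom_sum_zpar_ne_zero r) ?_ fun i j hij => ?_
  · rw [thetaRev₁₃, theta, ← TensorProduct.map_mul, ← TensorProduct.map_mul,
      ← TensorProduct.map_mul, ← TensorProduct.map_mul, E_par_mul_K_par, mul_par_mul_E_par,
      map_neg_left', map_neg_right', one_mul, mul_one, ρ_E_K, zpar, TensorProduct.map_smul_left,
      TensorProduct.map_smul_right, neg_smul, smul_neg, neg_neg]
  · rw [thetaRev₁₃, theta, TensorProduct.map_pow, TensorProduct.map_pow, TensorProduct.map_pow,
      TensorProduct.map_pow, ← TensorProduct.map_mul, ← TensorProduct.map_mul, ← pow_add,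
      pow_eq_zero_of_le hij W.ρ_F_pow, TensorProduct.map_zero_right, TensorProduct.map_zero_right]

lemma twistFwd_eq :
    (TensorProduct.assoc ℂ V.carrier W.carrier U.carrier).toLinearMap ∘ₗ twistFwd U V W ∘ₗ
      (TensorProduct.assoc ℂ U.carrier V.carrier W.carrier).toLinearMap =
    TensorProduct.map LinearMap.id (twist U W) ∘ₗ
      (TensorProduct.assoc ℂ V.carrier U.carrier W.carrier).toLinearMap ∘ₗ
        TensorProduct.map (twist U V) LinearMap.id := by
  refine tensor₃_ext_homog fun i j k lam μ ν u v w hu hv hw => ?_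
  have h1 : twistFwd U V W (u ⊗ₜ (v ⊗ₜ w)) =
    (koszulSign i (j + k) * qpow r (lam * (μ + ν) / 2)) • ((v ⊗ₜ w) ⊗ₜ u) :=
    twist_tmul hu (hv.tmul hw)
  simp only [LinearMap.comp_apply, TensorProduct.map_tmul, twist_tmul hu hv, h1,
    map_smul, ← TensorProduct.smul_tmul', TensorProduct.tmul_smul, twist_tmul hu hw,
    LinearEquiv.coe_coe, TensorProduct.assoc_tmul, LinearMap.id_apply, smul_smul]
  congr 1
  rw [koszulSign_add_right, show lam * (μ + ν) / 2 = lam * μ / 2 + lam * ν / 2 by ring, qpow_add]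
  ring

lemma twistRev_eq :
    (TensorProduct.assoc ℂ W.carrier U.carrier V.carrier).symm.toLinearMap ∘ₗ twistRev U V W ∘ₗ
      (TensorProduct.assoc ℂ U.carrier V.carrier W.carrier).symm.toLinearMap =
    TensorProduct.map (twist U W) LinearMap.id ∘ₗ
      (TensorProduct.assoc ℂ U.carrier W.carrier V.carrier).symm.toLinearMap ∘ₗ
        TensorProduct.map LinearMap.id (twist V W) := by
  refine tensor₃_ext_homog' fun i j k lam μ ν u v w hu hv hw => ?_
  have h1 : twistRev U V W ((u ⊗ₜ v) ⊗ₜ w) =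
    (koszulSign (i + j) k * qpow r ((lam + μ) * ν / 2)) • (w ⊗ₜ (u ⊗ₜ v)) :=
    twist_tmul (hu.tmul hv) hw
  simp only [LinearMap.comp_apply, TensorProduct.map_tmul, twist_tmul hv hw, h1,
    map_smul, ← TensorProduct.smul_tmul', TensorProduct.tmul_smul, twist_tmul hu hw,
    LinearEquiv.coe_coe, TensorProduct.assoc_symm_tmul, LinearMap.id_apply, smul_smul]
  congr 1
  rw [koszulSign_add_left, show (lam + μ) * ν / 2 = lam * ν / 2 + μ * ν / 2 by ring, qpow_add]
  ring

lemma hexagon_fwd :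
    (TensorProduct.assoc ℂ V.carrier W.carrier U.carrier).toLinearMap ∘ₗ
      (twistFwd U V W ∘ₗ rExp r (thetaFwd U V W)) ∘ₗ
        (TensorProduct.assoc ℂ U.carrier V.carrier W.carrier).toLinearMap =
    TensorProduct.map LinearMap.id (braidingMap U W) ∘ₗ
      (TensorProduct.assoc ℂ V.carrier U.carrier W.carrier).toLinearMap ∘ₗ
        TensorProduct.map (braidingMap U V) LinearMap.id := by
  have h1 := rExp_comp (r := r) (thetaFwd_comp_assoc U V W)
  have h2 := rExp_comp (r := r) (theta_comp_twist_fwd U V W)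
  have h3 : TensorProduct.map LinearMap.id (braidingMap U W) =
      TensorProduct.map LinearMap.id (twist U W) ∘ₗ
        rExp r (TensorProduct.map (1 : Module.End ℂ V.carrier) (theta U W)) := by
    rw [← map_one_rExp, braidingMap_eq, ← TensorProduct.map_comp]; rfl
  have h4 : TensorProduct.map (braidingMap U V) (LinearMap.id (M := W.carrier)) =
      TensorProduct.map (twist U V) LinearMap.id ∘ₗ
        TensorProduct.map (rExp r (theta U V)) (1 : Module.End ℂ W.carrier) := by
    rw [braidingMap_eq, ← TensorProduct.map_comp]; rfl
  refine LinearMap.ext fun x => ?_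
  have e1 := LinearMap.congr_fun h1 x
  have e2 := LinearMap.congr_fun h2 (TensorProduct.map (rExp r (theta U V)) 1 x)
  have e3 := LinearMap.congr_fun (twistFwd_eq U V W)
    (rExp r (thetaFwd₁₃ U V W) (TensorProduct.map (rExp r (theta U V)) 1 x))
  have e4 := LinearMap.congr_fun (rExp_fwd U V W) x
  rw [h3, h4]
  simp only [LinearMap.comp_apply] at e1 e2 e3 ⊢
  rw [e1, e2]
  refine Eq.trans ?_ e3
  exact congrArg _ (congrArg _ (congrArg _ e4))

lemma hexagon_rev :
    (TensorProduct.assoc ℂ W.carrier U.carrier V.carrier).symm.toLinearMap ∘ₗ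
      (twistRev U V W ∘ₗ rExp r (thetaRev U V W)) ∘ₗ
        (TensorProduct.assoc ℂ U.carrier V.carrier W.carrier).symm.toLinearMap =
    TensorProduct.map (braidingMap U W) LinearMap.id ∘ₗ
      (TensorProduct.assoc ℂ U.carrier W.carrier V.carrier).symm.toLinearMap ∘ₗ
        TensorProduct.map LinearMap.id (braidingMap V W) := by
  have h1 := rExp_comp (r := r) (thetaRev_comp_assoc_symm U V W)
  have h2 := rExp_comp (r := r) (theta_comp_twist_rev U V W)
  have h3 : TensorProduct.map (braidingMap U W) LinearMap.id =
      TensorProduct.map (twist U W) LinearMap.id ∘ₗ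
        rExp r (TensorProduct.map (theta U W) (1 : Module.End ℂ V.carrier)) := by
    rw [← map_rExp_one, braidingMap_eq, ← TensorProduct.map_comp]; rfl
  have h4 : TensorProduct.map (LinearMap.id (M := U.carrier)) (braidingMap V W) =
      TensorProduct.map LinearMap.id (twist V W) ∘ₗ
        TensorProduct.map (1 : Module.End ℂ U.carrier) (rExp r (theta V W)) := by
    rw [braidingMap_eq, ← TensorProduct.map_comp]; rfl
  refine LinearMap.ext fun x => ?_
  have e1 := LinearMap.congr_fun h1 x
  have e2 := LinearMap.congr_fun h2 (TensorProduct.map 1 (rExp r (theta V W)) x)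
  have e3 := LinearMap.congr_fun (twistRev_eq U V W)
    (rExp r (thetaRev₁₃ U V W) (TensorProduct.map 1 (rExp r (theta V W)) x))
  have e4 := LinearMap.congr_fun (rExp_rev U V W) x
  rw [h3, h4]
  simp only [LinearMap.comp_apply] at e1 e2 e3 ⊢
  rw [e1, e2]
  refine Eq.trans ?_ e3
  exact congrArg _ (congrArg _ (congrArg _ e4))

end Hexagon

/-- The braided structure given by the maps `c_{V,W}`. -/
noncomputable abbrev braidedCategory (r : ℕ) [Fact (3 ≤ r)] [Fact (r ≠ 4)] :
    BraidedCategory (WeightModule r) where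
  braiding V W := braidingIso V W
  braiding_naturality_right U V W f := hom_ext (braidingMap_natural (𝟙 U) f)
  braiding_naturality_left f W := hom_ext (braidingMap_natural f (𝟙 W))
  hexagon_forward U V W := hom_ext (by
    have h : twistFwd U V W ∘ₗ rExp r (thetaFwd U V W) = braidingMap U (tensor V W) :=
      (braidingMap_eq U (tensor V W)).symm
    have h' := hexagon_fwd U V W
    rw [h] at h'
    exact h')
  hexagon_reverse U V W := hom_ext (by
    have h : twistRev U V W ∘ₗ rExp r (thetaRev U V W) = braidingMap (tensor U V) W :=
      (braidingMap_eq (tensor U V) W).symm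
    have h' := hexagon_rev U V W
    rw [h] at h'
    exact h')

end WeightModule
end OspUnrolled

theorem mainTheorem8 (r : ℕ) [Fact (3 ≤ r)] [Fact (r ≠ 4)] :
    ∃ B : BraidedCategory (OspUnrolled.WeightModule r),
      ∀ (V W : OspUnrolled.WeightModule r) (x : V.carrier ⊗[ℂ] W.carrier),
        (B.braiding V W).hom.toLinearMap x = OspUnrolled.WeightModule.braidingMap V W x :=
  ⟨OspUnrolled.WeightModule.braidedCategory r, fun _ _ _ => rfl⟩
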